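/- **Setting.** Let $p$ be a prime and let $G$ be the Vilenkin group of all sequences $x=(x_k)_{k\in\mathbb Z}$ in $\mathbb Z/p\mathbb Z$ with $x_k=0$ for all sufficiently negative $k$, under coordinatewise addition. Put $G_n=\{x: x_k=0 \text{ for } k<n\}$ $(n\in\mathbb Z)$; the cosets of these subgroups form a base of the topology of $G$. Let $X$ be the (multiplicative) group of characters of $G$, write $(\chi,x)$ for the value of $\chi$ at $x$, and let $G_n^\perp\subset X$ be the annihilator of $G_n$. Let $\mu,\nu$ be the Haar measures of $G,X$ with $\mu(G_0)=\nu(G_0^\perp)=1$, and let $\hat f$ be the Fourier transform of $f\in L_2(G)$, that is, the $L_2(X)$-limit of $\int_{G_{-n}}f(x)\overline{(\chi,x)}\,d\mu(x)$ as $n\to\infty$. Let $\mathcal A$ be the dilation $(\mathcal Ax)_k=x_{k+1}$, put $(\chi\mathcal A,x)=(\chi,\mathcal Ax)$, and let $H_0=\{h\in G: h_k=0\text{ for }k\ge 0\}$. Fix characters $r_n\in G_{n+1}^\perp\setminus G_n^\perp$ $(n\in\mathbb Z)$. A mask is a function $m(\chi)=\sum_{h\in H_0}\beta_h\overline{(\chi\mathcal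 A^{-1},h)}$ with $(\beta_h)\in\ell^2(H_0)$, the series converging in $L_2(G_n^\perp)$ for every $n$. **Construction.** Let $M,N\ge 0$ be integers and let $\varphi\in L_2(G)$ vanish outside $G_{-N}$, be constant on the cosets of $G_M$, and be refinable, i.e. $\varphi(x)=p\sum_{h\in H_0}\beta_h\varphi(\mathcal Ax-h)$ in $L_2(G)$ for some $(\beta_h)\in\ell^2(H_0)$ (with corresponding mask $m_0$). Let $m_1,\dots,m_q$ be masks with $\hat\varphi(\chi\mathcal A^{-1})\,m_j(\chi)=\mathbf 1_{E_j}(\chi)$ almost everywhere, where $$E_j=G_{-s(j)}^\perp\, r_{-s(j)}^{\alpha^{(j)}_{-s(j)}}\,r_{-s(j)+1}^{\alpha^{(j)}_{-s(j)+1}}\cdots r_M^{\alpha^{(j)}_M},\qquad s(j)\in\{0,1,2,\dots\},\ \alpha^{(j)}_k\in\{0,\dots,p-1\},$$ are pairwise disjoint and, for each $n\in\mathbb Z$, the sets $E_j\mathcal A^n=\{\chi\mathcal A^n:\chi\in E_j\}$ $(j=1,\dots,q)$ are pairwise disjoint. Suppose there are integers $t(j)\ge 0$ such that $G_{M+1}^\perp\setminus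 G_M^\perp$ is the disjoint union of the sets $E_j\mathcal A^{t(j)}$, $j=1,\dots,q$. Let $\psi^{(j)}\in L_2(G)$ be given by $\hat\psi^{(j)}(\chi)=\hat\varphi(\chi\mathcal A^{-1})m_j(\chi)$, put $\psi^{(j)}_{n,h}(x)=p^{n/2}\psi^{(j)}(\mathcal A^nx-h)$ for $n\in\mathbb Z$, $h\in H_0$, and let $l=\max_j t(j)$. **Theorem 4.1.** For every integer $\tilde N>N$ and every $f\in L_2(G)$, the series below over $n\le\tilde N$, $1\le j\le q$, $h\in H_0$ converges unconditionally in $L_2(G)$, and $$\Big\|f-\sum_{n=-\infty}^{\tilde N}\sum_{j=1}^q\sum_{h\in H_0}\langle f,\psi^{(j)}_{n,h}\rangle\psi^{(j)}_{n,h}\Big\|_2\le p^{M/2}(N+1)\sum_{n=\tilde N+1}^\infty\Big(\int_{G_{n-l+M+1}^\perp\setminus G_{n-l+M}^\perp}|\hat f(\chi)|^2\,d\nu(\chi)\Big)^{1/2},$$ where the right-hand side may be $+\infty$. -/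

import Mathlib

open MeasureTheory Filter Topology
open scoped ENNReal Pointwise ComplexConjugate

noncomputable section

namespace VilenkinFrame

/-- The sequences `x = (x_k)_{k ∈ ℤ}` over `ℤ/pℤ` that vanish for all sufficiently negative
indices, as a subgroup of all sequences under coordinatewise addition modulo `p`. -/
def vilenkinSubgroup (p : ℕ) : AddSubgroup (ℤ → ZMod p) where
  carrier := {x | ∃ n : ℤ, ∀ k < n, x k = 0}
  zero_mem' := ⟨0, fun _ _ => rfl⟩
  add_mem' := by
    rintro x y ⟨m, hm⟩ ⟨n, hn⟩
    refine ⟨min m n, fun k hk => ?_⟩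
    simp [hm k (lt_of_lt_of_le hk (min_le_left _ _)), hn k (lt_of_lt_of_le hk (min_le_right _ _))]
  neg_mem' := by
    rintro x ⟨m, hm⟩
    exact ⟨m, fun k hk => by simp [hm k hk]⟩

/-- The Vilenkin group `G`. (It is a separate type so that it does not carry the topology induced
from the product.) -/
def Vilenkin (p : ℕ) : Type := vilenkinSubgroup p

instance (p : ℕ) : AddCommGroup (Vilenkin p) :=
  inferInstanceAs (AddCommGroup (vilenkinSubgroup p))

/-- The `k`-th coordinate of `x ∈ G`. -/
def coord {p : ℕ} (x : Vilenkin p) (k : ℤ) : ZMod p := x.1 k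

/-- The subgroup `G_n` of all `x` with `x_k = 0` for `k < n`. -/
def chain (p : ℕ) (n : ℤ) : AddSubgroup (Vilenkin p) where
  carrier := {x | ∀ k < n, coord x k = 0}
  zero_mem' := fun _ _ => rfl
  add_mem' := by
    intro x y hx hy k hk
    have h : coord (x + y) k = coord x k + coord y k := rfl
    rw [h, hx k hk, hy k hk, add_zero]
  neg_mem' := by
    intro x hx k hk
    have h : coord (-x) k = -coord x k := rfl
    rw [h, hx k hk, neg_zero]

/-- The topology of `G`, generated by the cosets of the subgroups `G_n`. -/
instance (p : ℕ) : TopologicalSpace (Vilenkin p) :=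
  TopologicalSpace.generateFrom
    {U | ∃ (a : Vilenkin p) (n : ℤ), U = {x | x - a ∈ chain p n}}

instance (p : ℕ) : MeasurableSpace (Vilenkin p) := borel _

instance (p : ℕ) : BorelSpace (Vilenkin p) := ⟨rfl⟩

/-- The group `X` of (continuous, unitary) characters of `G`, written multiplicatively, with the
compact-open topology. -/
abbrev Dual (p : ℕ) : Type := PontryaginDual (Multiplicative (Vilenkin p))

instance (p : ℕ) : MeasurableSpace (Dual p) := borel _

instance (p : ℕ) : BorelSpace (Dual p) := ⟨rfl⟩

/-- The value `(χ, x)` of the character `χ` at `x`. -/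
def pairing {p : ℕ} (χ : Dual p) (x : Vilenkin p) : ℂ := (χ (Multiplicative.ofAdd x) : Circle)

/-- The annihilator `G_n^⊥` of `G_n`. -/
def annih (p : ℕ) (n : ℤ) : Subgroup (Dual p) where
  carrier := {χ | ∀ x ∈ chain p n, χ (Multiplicative.ofAdd x) = 1}
  one_mem' := fun _ _ => rfl
  mul_mem' := by
    intro χ η hχ hη x hx
    have h : (χ * η) (Multiplicative.ofAdd x)
      = χ (Multiplicative.ofAdd x) * η (Multiplicative.ofAdd x) := rfl
    rw [h, hχ x hx, hη x hx, mul_one]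
  inv_mem' := by
    intro χ hχ x hx
    have h : (χ⁻¹) (Multiplicative.ofAdd x) = (χ (Multiplicative.ofAdd x))⁻¹ := rfl
    rw [h, hχ x hx, inv_one]

/-- The elements `h = a_{-1} g_{-1} + ⋯ + a_{-s} g_{-s}` of `G`, that is, those whose
coordinates of index `≥ 0` vanish. -/
def H0 (p : ℕ) : Set (Vilenkin p) := {h | ∀ k : ℤ, 0 ≤ k → coord h k = 0}

/-- The power `𝒜^n`, `n ∈ ℤ`, of the dilation operator `𝒜`, where `𝒜` is the shift
`(𝒜 x)_k = x_{k+1}`; it maps `g_m` to `g_{m-n}`. -/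
def dil {p : ℕ} (n : ℤ) : Vilenkin p →+ Vilenkin p where
  toFun x := ⟨fun k => coord x (k + n), by
    obtain ⟨m, hm⟩ := x.2
    exact ⟨m - n, fun k hk => hm (k + n) (by omega)⟩⟩
  map_zero' := rfl
  map_add' _ _ := rfl

theorem continuous_dil {p : ℕ} (n : ℤ) : Continuous (dil n : Vilenkin p → Vilenkin p) := by
  refine continuous_generateFrom_iff.2 ?_
  rintro U ⟨a, m, rfl⟩
  refine TopologicalSpace.isOpen_generateFrom_of_mem ⟨dil (-n) a, m + n, ?_⟩
  have key : ∀ (x : Vilenkin p) (k : ℤ),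
      coord (dil n x - a) k = coord (x - dil (-n) a) (k + n) := by
    intro x k
    have h1 : coord (dil n x - a) k = coord x (k + n) - coord a k := rfl
    have h2 : coord (x - dil (-n) a) (k + n) = coord x (k + n) - coord a (k + n + -n) := rfl
    rw [h1, h2, add_neg_cancel_right]
  ext x
  constructor
  · intro hx k hk
    have := hx (k - n) (by omega)
    rwa [key, sub_add_cancel] at this
  · intro hx k hk
    rw [key]
    exact hx (k + n) (by omega)

/-- The character `χ𝒜^n`, given by `(χ𝒜^n, x) = (χ, 𝒜^n x)`. -/
def dualDil {p : ℕ} (n : ℤ) (χ : Dual p) : Dual p :=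
  PontryaginDual.map
    (⟨AddMonoidHom.toMultiplicative (dil n), continuous_dil n⟩ :
      Multiplicative (Vilenkin p) →ₜ* Multiplicative (Vilenkin p)) χ

theorem pairing_dualDil {p : ℕ} (n : ℤ) (χ : Dual p) (x : Vilenkin p) :
    pairing (dualDil n χ) x = pairing χ (dil n x) := rfl

/-- `F` is (a version of) the Fourier transform of `f ∈ L₂(G)`: the `L₂(X)`-limit, as `n → ∞`, of
the functions `χ ↦ ∫_{G_{-n}} f(x) \overline{(χ, x)} dμ(x)`. -/
def IsFourierTransform {p : ℕ} (μ : Measure (Vilenkin p)) (ν : Measure (Dual p))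
    (f : Vilenkin p → ℂ) (F : Dual p → ℂ) : Prop :=
  MemLp f 2 μ ∧ MemLp F 2 ν ∧
    Tendsto (fun n : ℕ => eLpNorm (fun χ =>
      (∫ x in (chain p (-(n : ℤ)) : Set (Vilenkin p)), f x * conj (pairing χ x) ∂μ) - F χ) 2 ν)
      atTop (𝓝 0)

/-- The family `u` is unconditionally summable to `g` in the norm of `L₂(μ)`. -/
def HasL2Sum {Y ι : Type*} [MeasurableSpace Y] (μ : Measure Y) (u : ι → Y → ℂ) (g : Y → ℂ) :
    Prop :=
  MemLp g 2 μ ∧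
    Tendsto (fun S : Finset ι => eLpNorm (fun y => (∑ i ∈ S, u i y) - g y) 2 μ) atTop (𝓝 0)

/-- The class `𝔇_{G_M}(G_{-N})`: functions in `L₂(G)` that vanish outside `G_{-N}` and are constant
on the cosets of `G_M`. -/
def stepSpace {p : ℕ} (μ : Measure (Vilenkin p)) (M N : ℕ) : Set (Vilenkin p → ℂ) :=
  {f | MemLp f 2 μ ∧ (∀ x, x ∉ chain p (-(N : ℤ)) → f x = 0) ∧
    ∀ x, ∀ y ∈ chain p (M : ℤ), f (x + y) = f x}

/-- `m` is the mask `m(χ) = ∑_{h ∈ H₀} β_h \overline{(χ𝒜⁻¹, h)}` of the square-summable family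
`β`; the series converges in `L₂(G_n^⊥)` for every `n`. -/
def IsMaskOf {p : ℕ} (ν : Measure (Dual p)) (β : H0 p → ℂ) (m : Dual p → ℂ) : Prop :=
  Summable (fun h => ‖β h‖ ^ 2) ∧
    ∀ n : ℤ, HasL2Sum (ν.restrict (annih p n : Set (Dual p)))
      (fun (h : H0 p) χ => β h * conj (pairing (dualDil (-1) χ) (h : Vilenkin p))) m

/-- `φ` is refinable with mask `m₀`: there is `β ∈ ℓ²` with
`φ(x) = p ∑_{h ∈ H₀} β_h φ(𝒜x - h)` in `L₂(G)`, and `m₀` is the mask of `β`. -/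
def IsRefinable {p : ℕ} (μ : Measure (Vilenkin p)) (ν : Measure (Dual p))
    (φ : Vilenkin p → ℂ) (m₀ : Dual p → ℂ) : Prop :=
  ∃ β : H0 p → ℂ, IsMaskOf ν β m₀ ∧
    HasL2Sum μ (fun (h : H0 p) x => (p : ℂ) * β h * φ (dil 1 x - h)) φ

/-- The coset `G_{-s}^⊥ r_{-s}^{a_{-s}} r_{-s+1}^{a_{-s+1}} ⋯ r_M^{a_M}`. -/
def coset {p : ℕ} (r : ℤ → Dual p) (M s : ℕ) (a : ℤ → Fin p) : Set (Dual p) :=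
  (∏ k ∈ Finset.Icc (-(s : ℤ)) (M : ℤ), r k ^ (a k : ℕ)) • (annih p (-(s : ℤ)) : Set (Dual p))

/-- `ψ_{n,h}(x) = p^{n/2} ψ(𝒜^n x - h)`. -/
def frameElt {p : ℕ} (ψ : Vilenkin p → ℂ) (n : ℤ) (h : Vilenkin p) (x : Vilenkin p) : ℂ :=
  (((p : ℝ) ^ ((n : ℝ) / 2) : ℝ) : ℂ) * ψ (dil n x - h)

/-- The inner product of `L₂(G)`, linear in the first variable. -/
def ip {p : ℕ} (μ : Measure (Vilenkin p)) (f g : Vilenkin p → ℂ) : ℂ := ∫ x, f x * conj (g x) ∂μ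

/-- The shell `G_{k+1}^⊥ ∖ G_k^⊥`. -/
def shell (p : ℕ) (k : ℤ) : Set (Dual p) :=
  (annih p (k + 1) : Set (Dual p)) \ (annih p k : Set (Dual p))

end VilenkinFrame

end

noncomputable section
namespace VilenkinFrame

/-! ### Balls of the Vilenkin group -/

section Balls

variable {p : ℕ}

/-! The proof takes place on the Fourier side. Since `ψ j` has Fourier transform `1_{E_j}` and `E_j
= ξ_j G_{-s}^⊥` is one coset, `ψ j` equals `p^{-s} ξ_j` on `G_{-s}` and zero elsewhere
(`ae_eq_atom_of_isFourierTransform`). Hence every `ψ_{n,h}` is a scalar times the character `ξ_j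
𝒜^n` cut off to a ball, and its Fourier transform lives on the tile `E_j 𝒜^n`.

The tiles `E_j 𝒜^{t(j)}` partition one shell and dilations permute the shells, so all tiles `E_j
𝒜^n` together partition the nontrivial characters (`disjoint_dualDil_image`,
`exists_mem_dualDil_image`). Vectors from different tiles are therefore orthogonal. Within a tile,
two vectors are either orthogonal or differ by a phase. Each line is repeated `p^s` times by vectors
of squared norm `p^{-s}`, so the expansion reproduces `f` exactly on the tile. The sum over `n ≤ Ñ`
thus cuts `f̂` down to the tiles with `n ≤ Ñ`: the remainder has zero transform on these tiles
(`inner_frameVec_sub_hasSum`, `fourier_eq_zero_of_inner_frameVec`) and transform `f̂` on the others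
(`fourier_hasSum_eq_zero`).

A tile `E_j 𝒜^n` with `n > Ñ` lies in the shell of index `n - t(j) + M`, and `t(j) ≤ l`, so the
error is at most the `L₂` norm of `f̂` over the shells in the bound. Subadditivity of the square
root finishes the estimate; the factor `p^{M/2}(N+1)` enters only through being at least one.

Plancherel comes from indicators of balls: they are total in `L₂(G)` and have the same Gram matrix
as their transforms, which gives an isometry `L` (`exists_fourier`). By `IsFourierTransform.ae_eq`
every Fourier transform in the sense of the limit definition agrees with `L`. -/

@[ext]
theorem Vilenkin.ext {x y : Vilenkin p} (h : ∀ k, coord x k = coord y k) : x = y :=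
  Subtype.ext (funext h)

@[simp] theorem coord_add (x y : Vilenkin p) (k : ℤ) : coord (x + y) k = coord x k + coord y k :=
  rfl

@[simp] theorem coord_neg (x : Vilenkin p) (k : ℤ) : coord (-x) k = -coord x k := rfl

@[simp] theorem coord_sub (x y : Vilenkin p) (k : ℤ) : coord (x - y) k = coord x k - coord y k :=
  rfl

@[simp] theorem coord_zero (k : ℤ) : coord (0 : Vilenkin p) k = 0 := rfl

@[simp] theorem coord_nsmul (n : ℕ) (x : Vilenkin p) (k : ℤ) :
    coord (n • x) k = n • coord x k := by
  induction n with
  | zero => simp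
  | succ n ih => simp [succ_nsmul, ih, add_mul]

@[simp] theorem coord_dil (n : ℤ) (x : Vilenkin p) (k : ℤ) : coord (dil n x) k = coord x (k + n) :=
  rfl

theorem mem_chain {n : ℤ} {x : Vilenkin p} : x ∈ chain p n ↔ ∀ k < n, coord x k = 0 := Iff.rfl

/-- The coset `a + G_k`. -/
def ball (a : Vilenkin p) (k : ℤ) : Set (Vilenkin p) := {x | x - a ∈ chain p k}

theorem mem_ball {a x : Vilenkin p} {k : ℤ} : x ∈ ball a k ↔ x - a ∈ chain p k := Iff.rfl

theorem mem_ball_iff_coord {a x : Vilenkin p} {k : ℤ} :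
    x ∈ ball a k ↔ ∀ j < k, coord x j = coord a j := by
  simp [mem_ball, mem_chain, sub_eq_zero]

theorem mem_ball_self (a : Vilenkin p) (k : ℤ) : a ∈ ball a k :=
  mem_ball_iff_coord.2 fun _ _ => rfl

theorem ball_zero (k : ℤ) : ball (0 : Vilenkin p) k = chain p k := by
  ext x; simp [mem_ball]

theorem ball_eq_of_mem {a b : Vilenkin p} {k : ℤ} (h : b ∈ ball a k) : ball b k = ball a k := by
  rw [mem_ball_iff_coord] at h
  ext x
  simp only [mem_ball_iff_coord]
  exact forall₂_congr fun j hj => by rw [h j hj]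

theorem ball_subset_ball {a : Vilenkin p} {k m : ℤ} (h : k ≤ m) : ball a m ⊆ ball a k := by
  intro x hx
  rw [mem_ball_iff_coord] at *
  exact fun j hj => hx j (by lia)

theorem chain_le_chain {k m : ℤ} (h : k ≤ m) : chain p m ≤ chain p k := by
  intro x hx j hj
  exact hx j (by lia)

theorem ball_disjoint {a b : Vilenkin p} {k : ℤ} (h : b ∉ ball a k) :
    Disjoint (ball a k) (ball b k) := by
  rw [Set.disjoint_left]
  intro x hx hx'
  exact h (by rw [← ball_eq_of_mem hx, ball_eq_of_mem hx']; exact mem_ball_self b k)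

-- The ultrametric alternative: two balls are nested or disjoint.
open Classical in
theorem ball_inter_eq {a b : Vilenkin p} {k m : ℤ} (h : k ≤ m) :
    ball a k ∩ ball b m = if b ∈ ball a k then ball b m else ∅ := by
  split_ifs with hb
  · rw [Set.inter_eq_right, ← ball_eq_of_mem hb]
    exact ball_subset_ball h
  · exact Set.disjoint_iff_inter_eq_empty.1
      ((ball_disjoint hb).mono_right (ball_subset_ball h))

theorem ball_inter_ball (a b : Vilenkin p) (k m : ℤ) :
    ball a k ∩ ball b m = ∅ ∨ ∃ c n, ball a k ∩ ball b m = ball c n := by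
  rcases le_total k m with h | h
  · rw [ball_inter_eq h]
    split_ifs
    · exact Or.inr ⟨b, m, rfl⟩
    · exact Or.inl rfl
  · rw [Set.inter_comm, ball_inter_eq h]
    split_ifs
    · exact Or.inr ⟨a, k, rfl⟩
    · exact Or.inl rfl

theorem iUnion_chain : ⋃ n : ℕ, (chain p (-(n : ℤ)) : Set (Vilenkin p)) = Set.univ := by
  rw [Set.eq_univ_iff_forall]
  intro x
  obtain ⟨m, hm⟩ := x.2
  exact Set.mem_iUnion.2 ⟨m.natAbs, fun k hk => hm k (by lia)⟩

theorem isOpen_ball (a : Vilenkin p) (k : ℤ) : IsOpen (ball a k) :=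
  TopologicalSpace.isOpen_generateFrom_of_mem ⟨a, k, rfl⟩

theorem isTopologicalBasis_ball : TopologicalSpace.IsTopologicalBasis
    {U : Set (Vilenkin p) | ∃ (a : Vilenkin p) (n : ℤ), U = ball a n} where
  exists_subset_inter := by
    rintro _ ⟨a, k, rfl⟩ _ ⟨b, m, rfl⟩ x ⟨hx, hx'⟩
    refine ⟨ball x (max k m), ⟨x, _, rfl⟩, mem_ball_self _ _, Set.subset_inter ?_ ?_⟩
    · rw [← ball_eq_of_mem hx]
      exact ball_subset_ball (le_max_left _ _)
    · rw [← ball_eq_of_mem hx']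
      exact ball_subset_ball (le_max_right _ _)
  sUnion_eq := Set.eq_univ_iff_forall.2 fun x => ⟨ball x 0, ⟨x, 0, rfl⟩, mem_ball_self x 0⟩
  eq_generateFrom := rfl

instance : IsTopologicalAddGroup (Vilenkin p) where
  continuous_add := by
    refine continuous_generateFrom_iff.2 ?_
    rintro _ ⟨a, n, rfl⟩
    rw [isOpen_iff_mem_nhds]
    rintro ⟨x, y⟩ hxy
    refine mem_of_superset (prod_mem_nhds ((isOpen_ball x n).mem_nhds (mem_ball_self x n))
      ((isOpen_ball y n).mem_nhds (mem_ball_self y n))) ?_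
    rintro ⟨x', y'⟩ ⟨hx, hy⟩
    change x + y ∈ ball a n at hxy
    change x' + y' ∈ ball a n
    simp only [mem_ball_iff_coord, coord_add] at *
    intro j hj
    rw [hx j hj, hy j hj, hxy j hj]
  continuous_neg := by
    refine continuous_generateFrom_iff.2 ?_
    rintro _ ⟨a, n, rfl⟩
    convert isOpen_ball (-a) n using 1
    ext x
    change -x ∈ ball a n ↔ _
    simp only [mem_ball_iff_coord, coord_neg, neg_eq_iff_eq_neg]

/-- A ball fixes the coordinates below `n`, and its centre vanishes far to the left, so finitely
many residues and `n` encode it. -/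
theorem countable_balls [NeZero p] :
    {U : Set (Vilenkin p) | ∃ (a : Vilenkin p) (n : ℤ), U = ball a n}.Countable := by
  refine (Set.countable_range fun F : (ℤ →₀ ZMod p) × ℤ =>
    {x : Vilenkin p | ∀ k < F.2, coord x k = F.1 k}).mono ?_
  rintro _ ⟨a, n, rfl⟩
  obtain ⟨m, hm⟩ := a.2
  refine ⟨(Finsupp.onFinset (Finset.Ico m n) (fun k => if k < n then coord a k else 0) ?_, n), ?_⟩
  · intro k hk
    simp only [ne_eq, ite_eq_right_iff, not_forall] at hk
    obtain ⟨h1, h2⟩ := hk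
    rw [Finset.mem_Ico]
    refine ⟨?_, h1⟩
    by_contra h
    exact h2 (hm k (not_le.1 h))
  · ext x
    simp only [Finsupp.onFinset_apply, Set.mem_ofPred_eq, mem_ball_iff_coord]
    exact forall₂_congr fun j hj => by rw [if_pos hj]

instance [NeZero p] : SecondCountableTopology (Vilenkin p) :=
  isTopologicalBasis_ball.secondCountableTopology countable_balls

theorem borel_eq_generateFrom_ball [NeZero p] :
    (inferInstance : MeasurableSpace (Vilenkin p)) = MeasurableSpace.generateFrom
      {U : Set (Vilenkin p) | ∃ (a : Vilenkin p) (n : ℤ), U = ball a n} :=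
  borel_eq_generateFrom_of_subbasis rfl

theorem isPiSystem_ball : IsPiSystem
    {U : Set (Vilenkin p) | ∃ (a : Vilenkin p) (n : ℤ), U = ball a n} := by
  rintro _ ⟨a, k, rfl⟩ _ ⟨b, m, rfl⟩ hne
  rcases ball_inter_ball a b k m with h | h
  · exact absurd h hne.ne_empty
  · exact h

theorem measurableSet_ball (a : Vilenkin p) (k : ℤ) : MeasurableSet (ball a k) :=
  (isOpen_ball a k).measurableSet

theorem measurableSet_chain (k : ℤ) : MeasurableSet (chain p k : Set (Vilenkin p)) := by
  rw [← ball_zero]; exact measurableSet_ball 0 k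

/-- The sequence with `c` at the index `k` and zeros elsewhere. -/
def single (k : ℤ) (c : ZMod p) : Vilenkin p :=
  ⟨Pi.single k c, k, fun _ hj => Pi.single_eq_of_ne (M := fun _ : ℤ => ZMod p) (ne_of_lt hj) c⟩

@[simp] theorem coord_single_self (k : ℤ) (c : ZMod p) : coord (single k c) k = c :=
  Pi.single_eq_same (M := fun _ : ℤ => ZMod p) k c

theorem coord_single_of_ne {k j : ℤ} (h : j ≠ k) (c : ZMod p) : coord (single k c) j = 0 :=
  Pi.single_eq_of_ne (M := fun _ : ℤ => ZMod p) h c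

theorem single_mem_chain {k n : ℤ} (h : n ≤ k) (c : ZMod p) : single k c ∈ chain p n :=
  fun j hj => coord_single_of_ne (by lia) c

theorem ball_eq_iUnion_ball_succ (a : Vilenkin p) (k : ℤ) :
    ball a k = ⋃ c : ZMod p, ball (a + single k c) (k + 1) := by
  ext x
  simp only [Set.mem_iUnion, mem_ball_iff_coord, coord_add]
  constructor
  · intro h
    refine ⟨coord x k - coord a k, fun j hj => ?_⟩
    rcases eq_or_ne j k with rfl | hne
    · simp
    · rw [coord_single_of_ne hne, add_zero]
      exact h j (by lia)
  · rintro ⟨c, h⟩ j hj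
    rw [h j (by lia), coord_single_of_ne (by lia), add_zero]

theorem pairwise_disjoint_ball_succ (a : Vilenkin p) (k : ℤ) :
    Pairwise (Function.onFun Disjoint fun c : ZMod p => ball (a + single k c) (k + 1)) := by
  intro c d hcd
  refine ball_disjoint fun h => hcd ?_
  have := mem_ball_iff_coord.1 h k (by lia)
  simpa [eq_comm] using this

end Balls

/-! ### Haar measure of balls and its behaviour under dilation -/

section Haar

variable {p : ℕ} [NeZero p] (μ : Measure (Vilenkin p)) [μ.IsAddHaarMeasure]

omit [NeZero p] in
theorem measure_ball_eq_chain (a : Vilenkin p) (k : ℤ) :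
    μ (ball a k) = μ (chain p k : Set (Vilenkin p)) := by
  rw [← measure_preimage_add μ a (ball a k)]
  congr 1
  ext x
  simp [mem_ball]

theorem measure_chain_eq_mul (k : ℤ) :
    μ (chain p k : Set (Vilenkin p)) = p * μ (chain p (k + 1) : Set (Vilenkin p)) := by
  rw [← ball_zero, ball_eq_iUnion_ball_succ, measure_iUnion (pairwise_disjoint_ball_succ 0 k)
    (fun c => measurableSet_ball _ _), tsum_fintype]
  simp [measure_ball_eq_chain]

variable {μ}

theorem measure_chain (hμ : μ (chain p 0 : Set (Vilenkin p)) = 1) (k : ℤ) :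
    μ (chain p k : Set (Vilenkin p)) = (p : ℝ≥0∞) ^ (-k) := by
  have hp0 : (p : ℝ≥0∞) ≠ 0 := by simpa using NeZero.ne p
  have hpt : (p : ℝ≥0∞) ≠ ∞ := ENNReal.natCast_ne_top p
  have hmul : ∀ n : ℤ, (p : ℝ≥0∞) * (p : ℝ≥0∞) ^ n = (p : ℝ≥0∞) ^ (1 + n) := fun n => by
    rw [ENNReal.zpow_add hp0 hpt, zpow_one]
  induction k using Int.induction_on with
  | zero => simpa using hμ
  | succ k ih =>
    rw [measure_chain_eq_mul] at ih
    have h : (p : ℝ≥0∞) ^ (-(k : ℤ)) = p * (p : ℝ≥0∞) ^ (-((k : ℤ) + 1)) := by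
      rw [hmul]
      congr 1; ring
    rw [h] at ih
    exact (ENNReal.mul_right_inj hp0 hpt).1 ih
  | pred k ih =>
    rw [measure_chain_eq_mul, sub_add_cancel, ih]
    rw [hmul]
    congr 1; ring

theorem measure_ball (hμ : μ (chain p 0 : Set (Vilenkin p)) = 1) (a : Vilenkin p) (k : ℤ) : μ (ball a k) = (p : ℝ≥0∞) ^ (-k) := by
  rw [measure_ball_eq_chain, measure_chain hμ]

theorem measure_ball_lt_top (hμ : μ (chain p 0 : Set (Vilenkin p)) = 1) (a : Vilenkin p) (k : ℤ) :
    μ (ball a k) < ∞ := by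
  rw [measure_ball hμ]
  exact ENNReal.zpow_lt_top (by simpa using NeZero.ne p) (ENNReal.natCast_ne_top p) _

theorem _root_.ENNReal.toReal_natCast_zpow (n : ℕ) (k : ℤ) :
    ((n : ℝ≥0∞) ^ k).toReal = (n : ℝ) ^ k := by
  cases k with
  | ofNat m => simp only [Int.ofNat_eq_natCast, zpow_natCast, ENNReal.toReal_pow,
      ENNReal.toReal_natCast]
  | negSucc m => simp only [zpow_negSucc, ENNReal.toReal_inv, ENNReal.toReal_pow,
      ENNReal.toReal_natCast]

theorem measureReal_ball (hμ : μ (chain p 0 : Set (Vilenkin p)) = 1) (a : Vilenkin p) (k : ℤ) :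
    μ.real (ball a k) = (p : ℝ) ^ (-k) := by
  rw [Measure.real, measure_ball hμ, ENNReal.toReal_natCast_zpow]

omit [NeZero p] in
theorem dil_preimage_ball (n : ℤ) (a : Vilenkin p) (k : ℤ) :
    dil n ⁻¹' ball a k = ball (dil (-n) a) (k + n) := by
  ext x
  simp only [Set.mem_preimage, mem_ball_iff_coord, coord_dil]
  constructor
  · intro h j hj
    have := h (j - n) (by lia)
    rwa [sub_add_cancel] at this
  · intro h j hj
    have := h (j + n) (by lia)
    rwa [add_neg_cancel_right] at this

omit [NeZero p] in
theorem measurable_dil (n : ℤ) : Measurable (dil n : Vilenkin p → Vilenkin p) :=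
  (continuous_dil n).measurable

/-- The dilation `𝒜^n` divides Haar measure by `p^n`. -/
theorem map_dil (hμ : μ (chain p 0 : Set (Vilenkin p)) = 1) (n : ℤ) :
    μ.map (dil n) = (p : ℝ≥0∞) ^ (-n) • μ := by
  have hp0 : (p : ℝ≥0∞) ≠ 0 := by simpa using NeZero.ne p
  have hpt : (p : ℝ≥0∞) ≠ ∞ := ENNReal.natCast_ne_top p
  have hball : ∀ (a : Vilenkin p) (k : ℤ),
      μ.map (dil n) (ball a k) = (p : ℝ≥0∞) ^ (-n - k) := by
    intro a k
    rw [Measure.map_apply (measurable_dil n) (measurableSet_ball a k), dil_preimage_ball,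
      measure_ball hμ]
    congr 1; ring
  refine Measure.ext_of_generateFrom_of_iUnion _ (fun n : ℕ => ball 0 (-(n : ℤ)))
    borel_eq_generateFrom_ball isPiSystem_ball ?_ (fun n => ⟨0, _, rfl⟩) (fun m => ?_) ?_
  · simpa only [ball_zero] using iUnion_chain
  · rw [hball]
    exact (ENNReal.zpow_lt_top hp0 hpt _).ne
  · rintro _ ⟨a, k, rfl⟩
    rw [hball, Measure.smul_apply, measure_ball hμ, smul_eq_mul, ← ENNReal.zpow_add hp0 hpt]
    congr 1

/-- Affine dilations preserve null sets. -/
theorem quasiMeasurePreserving_dil_sub (hμ : μ (chain p 0 : Set (Vilenkin p)) = 1) (n : ℤ)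
    (h : Vilenkin p) : Measure.QuasiMeasurePreserving (fun x => dil n x - h) μ μ := by
  have h1 : Measure.QuasiMeasurePreserving (dil n : Vilenkin p → Vilenkin p) μ μ :=
    ⟨measurable_dil n, by rw [map_dil hμ]; exact Measure.smul_absolutelyContinuous⟩
  exact (measurePreserving_sub_right μ h).quasiMeasurePreserving.comp h1

/-- A square-integrable function whose integrals over all balls vanish is zero. -/
theorem ae_eq_zero_of_forall_setIntegral_ball (hμ : μ (chain p 0 : Set (Vilenkin p)) = 1)
    {f : Vilenkin p → ℂ} (hf : MemLp f 2 μ) (h0 : ∀ a k, ∫ x in ball a k, f x ∂μ = 0) :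
    f =ᵐ[μ] 0 := by
  have key : ∀ n : ℕ, f =ᵐ[μ.restrict (chain p (-(n : ℤ)) : Set (Vilenkin p))] 0 := by
    intro n
    rw [← ball_zero]
    set C := ball (0 : Vilenkin p) (-(n : ℤ))
    have hC : MeasurableSet C := measurableSet_ball _ _
    have : IsFiniteMeasure (μ.restrict C) :=
      ⟨by rw [Measure.restrict_apply_univ]; exact measure_ball_lt_top hμ _ _⟩
    have hint : Integrable f (μ.restrict C) :=
      (hf.restrict C).integrable (by norm_num)
    refine hint.ae_eq_zero_of_forall_setIntegral_eq_zero fun s hs hs' => ?_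
    clear hs'
    -- Induction from the π-system of balls: a ball meets `C` in a ball or not at all, so the
    -- hypothesis covers the basic case. Finite measure of `C` makes `f` integrable there, as the
    -- complement and union steps need.
    induction s, hs using MeasurableSpace.induction_on_inter (borel_eq_generateFrom_ball (p := p))
      (isPiSystem_ball (p := p)) with
    | empty => simp
    | basic t ht =>
      obtain ⟨a, k, rfl⟩ := ht
      rw [Measure.restrict_restrict (measurableSet_ball a k)]
      rcases ball_inter_ball a 0 k (-(n : ℤ)) with h | ⟨c, m, h⟩
      · rw [h]; simp
      · rw [h]; exact h0 c m
    | compl t ht ih =>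
      have h1 := integral_add_compl ht hint
      rw [ih, zero_add] at h1
      rw [h1]
      exact h0 0 _
    | iUnion g hd hg ih =>
      rw [integral_iUnion hg hd hint.integrableOn]
      simp [ih]
  have h2 := (ae_restrict_iUnion_iff _ _).2 key
  rwa [iUnion_chain, Measure.restrict_univ] at h2

end Haar
end VilenkinFrame
end

noncomputable section
namespace VilenkinFrame

/-! ### Characters -/

section Characters

variable {p : ℕ}

theorem pairing_mul (χ η : Dual p) (x : Vilenkin p) :
    pairing (χ * η) x = pairing χ x * pairing η x := rfl

theorem norm_pairing (χ : Dual p) (x : Vilenkin p) : ‖pairing χ x‖ = 1 := Circle.norm_coe _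

theorem pairing_ne_zero (χ : Dual p) (x : Vilenkin p) : pairing χ x ≠ 0 := Circle.coe_ne_zero _

theorem conj_pairing (χ : Dual p) (x : Vilenkin p) : conj (pairing χ x) = pairing χ⁻¹ x :=
  (Circle.coe_inv_eq_conj _).symm

theorem pairing_one (x : Vilenkin p) : pairing (1 : Dual p) x = 1 := rfl

theorem conj_pairing_mul_pairing (χ : Dual p) (x : Vilenkin p) :
    conj (pairing χ x) * pairing χ x = 1 := by
  rw [conj_pairing, ← pairing_mul, inv_mul_cancel, pairing_one]

theorem pairing_add (χ : Dual p) (x y : Vilenkin p) :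
    pairing χ (x + y) = pairing χ x * pairing χ y := by
  simp only [pairing, ofAdd_add, map_mul, Circle.coe_mul]

theorem pairing_zero (χ : Dual p) : pairing χ 0 = 1 := by
  simp only [pairing, ofAdd_zero, map_one, Circle.coe_one]

theorem pairing_neg (χ : Dual p) (x : Vilenkin p) : pairing χ (-x) = conj (pairing χ x) := by
  rw [conj_pairing]
  simp only [pairing, ofAdd_neg, map_inv]
  rfl

theorem pairing_sub (χ : Dual p) (x y : Vilenkin p) :
    pairing χ (x - y) = pairing χ x * conj (pairing χ y) := by
  rw [sub_eq_add_neg, pairing_add, pairing_neg]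

theorem pairing_nsmul (χ : Dual p) (n : ℕ) (x : Vilenkin p) :
    pairing χ (n • x) = pairing χ x ^ n := by
  induction n with
  | zero => simp [pairing_zero]
  | succ n ih => rw [succ_nsmul, pairing_add, ih, pow_succ]

theorem pairing_pow (χ : Dual p) (n : ℕ) (x : Vilenkin p) :
    pairing (χ ^ n) x = pairing χ x ^ n := by
  induction n with
  | zero => simp [pairing_one]
  | succ n ih => rw [pow_succ, pairing_mul, ih, pow_succ]

theorem pairing_pow_char (χ : Dual p) (x : Vilenkin p) : pairing χ x ^ p = 1 := by
  rw [← pairing_nsmul, ← pairing_zero χ]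
  congr 1
  ext k
  simp

theorem dual_ext {χ η : Dual p} (h : ∀ x, pairing χ x = pairing η x) : χ = η :=
  PontryaginDual.ext fun x => Circle.ext (h (Multiplicative.toAdd x))

theorem continuous_pairing (χ : Dual p) : Continuous (pairing χ) :=
  (continuous_subtype_val : Continuous ((↑) : Circle → ℂ)).comp (map_continuous χ)

theorem continuous_pairing_left (x : Vilenkin p) : Continuous fun χ : Dual p => pairing χ x := by
  refine (continuous_subtype_val : Continuous ((↑) : Circle → ℂ)).comp ?_
  have h : Continuous fun χ : Multiplicative (Vilenkin p) →ₜ* Circle =>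
      χ (Multiplicative.ofAdd x) :=
    (continuous_eval_const (F := C(Multiplicative (Vilenkin p), Circle)) (Multiplicative.ofAdd x)).comp
      (ContinuousMonoidHom.isInducing_toContinuousMap _ _).continuous
  exact h

theorem mem_annih {n : ℤ} {χ : Dual p} : χ ∈ annih p n ↔ ∀ x ∈ chain p n, pairing χ x = 1 :=
  forall₂_congr fun _ _ => Circle.coe_eq_one.symm

theorem annih_le_annih {k m : ℤ} (h : k ≤ m) : annih p k ≤ annih p m :=
  fun _ hχ x hx => hχ x (chain_le_chain h hx)

theorem isClosed_annih (n : ℤ) : IsClosed (annih p n : Set (Dual p)) := by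
  have h : (annih p n : Set (Dual p)) = ⋂ x ∈ chain p n, {χ | pairing χ x = 1} := by
    ext χ
    simp [mem_annih]
  rw [h]
  exact isClosed_biInter fun x _ => isClosed_eq (continuous_pairing_left x) continuous_const

theorem measurableSet_annih (n : ℤ) : MeasurableSet (annih p n : Set (Dual p)) :=
  (isClosed_annih n).measurableSet

theorem measurableSet_shell (n : ℤ) : MeasurableSet (shell p n) :=
  (measurableSet_annih _).diff (measurableSet_annih _)

/-- Every character is trivial on some `G_n`. -/
theorem exists_mem_annih [NeZero p] (χ : Dual p) : ∃ n : ℕ, χ ∈ annih p n := by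
  -- Characters take values in the `p`-th roots of unity, where `1` is isolated; continuity at zero
  -- then forces the value `1` on a whole subgroup `G_n`.
  have hfin : {z : ℂ | z ^ p = 1 ∧ z ≠ 1}.Finite :=
    (Polynomial.nthRootsFinset p (1 : ℂ)).finite_toSet.subset fun z hz => by
      simpa [Polynomial.mem_nthRootsFinset (NeZero.pos p)] using hz.1
  have hU : IsOpen ((pairing χ) ⁻¹' {z : ℂ | z ^ p = 1 ∧ z ≠ 1}ᶜ) :=
    hfin.isClosed.isOpen_compl.preimage (continuous_pairing χ)
  obtain ⟨_, ⟨a, n, rfl⟩, h0, hsub⟩ := isTopologicalBasis_ball.exists_subset_of_mem_open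
    (a := (0 : Vilenkin p)) (by simp [pairing_zero]) hU
  refine ⟨n.natAbs, mem_annih.2 fun x hx => ?_⟩
  have hx' : x ∈ ball a n := by
    rw [← ball_eq_of_mem h0]
    exact ball_subset_ball (m := (n.natAbs : ℤ)) (by lia) (by rwa [ball_zero])
  have := hsub hx'
  by_contra h
  exact this ⟨pairing_pow_char χ x, h⟩

theorem eq_one_of_forall_mem_annih {χ : Dual p} (h : ∀ n : ℕ, χ ∈ annih p (-(n : ℤ))) : χ = 1 := by
  refine dual_ext fun x => ?_
  obtain ⟨n, hn⟩ := Set.mem_iUnion.1 (iUnion_chain.ge (Set.mem_univ x))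
  exact mem_annih.1 (h n) x hn

/-- Every nontrivial character lies in some shell. -/
theorem exists_mem_shell [NeZero p] {χ : Dual p} (h : χ ≠ 1) : ∃ k, χ ∈ shell p k := by
  obtain ⟨n, hn⟩ := exists_mem_annih χ
  have h2 : ∃ m : ℕ, χ ∉ annih p (-(m : ℤ)) := by
    by_contra! hc
    exact h (eq_one_of_forall_mem_annih hc)
  obtain ⟨m, hm⟩ := h2
  obtain ⟨k, hk, hleast⟩ := Int.exists_least_of_bdd (P := fun k => χ ∈ annih p k)
    ⟨-m, fun z hz => by
      by_contra! hlt
      exact hm (annih_le_annih hlt.le hz)⟩ ⟨n, hn⟩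
  refine ⟨k - 1, by rwa [sub_add_cancel], fun hc => ?_⟩
  have := hleast _ hc
  lia

theorem disjoint_shell {k m : ℤ} (h : k ≠ m) : Disjoint (shell p k) (shell p m) := by
  rw [Set.disjoint_left]
  rintro χ ⟨h1, h2⟩ ⟨h3, h4⟩
  rcases lt_or_gt_of_ne h with h | h
  · exact h4 (annih_le_annih (by lia) h1)
  · exact h2 (annih_le_annih (by lia) h3)

/-- Modulo `G_{n+1}`, where `χ` is trivial, `x` is a multiple of the `n`-th unit vector. So one root
of unity determines `χ` on `G_n`. -/
theorem pairing_eq_pow_of_mem [NeZero p] {n : ℤ} {χ : Dual p} (hχ : χ ∈ annih p (n + 1))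
    {x : Vilenkin p} (hx : x ∈ chain p n) :
    pairing χ x = pairing χ (single n 1) ^ (coord x n).val := by
  rw [← pairing_nsmul]
  have hy : x - (coord x n).val • single n 1 ∈ chain p (n + 1) := by
    intro j hj
    rcases eq_or_ne j n with rfl | hne
    · simp
    · simp [coord_single_of_ne hne, hx j (by lia)]
  have := mem_annih.1 hχ _ hy
  rw [← sub_add_cancel x ((coord x n).val • single n 1), pairing_add, this, one_mul,
    sub_add_cancel]

theorem mem_annih_iff_of_mem_succ [NeZero p] {n : ℤ} {χ : Dual p} (hχ : χ ∈ annih p (n + 1)) :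
    χ ∈ annih p n ↔ pairing χ (single n 1) = 1 := by
  refine ⟨fun h => mem_annih.1 h _ (single_mem_chain le_rfl 1), fun h => mem_annih.2 fun x hx => ?_⟩
  rw [pairing_eq_pow_of_mem hχ hx, h, one_pow]

theorem isPrimitiveRoot_pairing [Fact p.Prime] {n : ℤ} {r : Dual p} (hr : r ∈ shell p n) :
    IsPrimitiveRoot (pairing r (single n 1)) p := by
  have h : orderOf (pairing r (single n 1)) = p := by
    refine orderOf_eq_prime (pairing_pow_char r _) fun h => hr.2 ?_
    exact (mem_annih_iff_of_mem_succ hr.1).2 h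
  simpa [h] using IsPrimitiveRoot.orderOf (pairing r (single n 1))

/-- Characters that are trivial on `G_k` separate the cosets of `G_k`. -/
theorem exists_mem_annih_pairing_ne_one [Fact p.Prime] {r : ℤ → Dual p}
    (hr : ∀ n, r n ∈ shell p n) {k : ℤ} {a : Vilenkin p} (ha : a ∉ chain p k) :
    ∃ η ∈ annih p k, pairing η a ≠ 1 := by
  rw [mem_chain] at ha
  push Not at ha
  obtain ⟨i, hi, hai⟩ := ha
  obtain ⟨m, hm⟩ := a.2
  obtain ⟨j, hj, hleast⟩ := Int.exists_least_of_bdd (P := fun j => coord a j ≠ 0)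
    ⟨m, fun z hz => by
      by_contra! hlt
      exact hz (hm z hlt)⟩ ⟨i, hai⟩
  have hji := hleast i hai
  have haj : a ∈ chain p j := fun z hz => by
    by_contra hc
    exact absurd (hleast z hc) (by lia)
  refine ⟨r j, annih_le_annih (by lia) (hr j).1, ?_⟩
  rw [pairing_eq_pow_of_mem (hr j).1 haj]
  exact (isPrimitiveRoot_pairing (hr j)).pow_ne_one_of_pos_of_lt
    (by rwa [ne_eq, ZMod.val_eq_zero]) (ZMod.val_lt _)

/-- The value of `r` at the `n`-th unit vector is a primitive `p`-th root of unity, so some power of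
`r` matches `χ` there, and the quotient is trivial on `G_n`. -/
theorem annih_succ_eq_iUnion [Fact p.Prime] {n : ℤ} {r : Dual p} (hr : r ∈ shell p n) :
    (annih p (n + 1) : Set (Dual p)) = ⋃ i : Fin p, r ^ (i : ℕ) • (annih p n : Set (Dual p)) := by
  ext χ
  simp only [Set.mem_iUnion, Set.mem_smul_set_iff_inv_smul_mem, smul_eq_mul, SetLike.mem_coe]
  constructor
  · intro hχ
    obtain ⟨i, hi, h⟩ := (isPrimitiveRoot_pairing hr).eq_pow_of_pow_eq_one
      (pairing_pow_char χ (single n 1))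
    refine ⟨⟨i, hi⟩, ?_⟩
    rw [mem_annih_iff_of_mem_succ (mul_mem (inv_mem (pow_mem hr.1 _)) hχ), pairing_mul,
      ← conj_pairing, pairing_pow, ← h, ← pairing_pow, conj_pairing_mul_pairing]
  · rintro ⟨i, hi⟩
    have := mul_mem (pow_mem hr.1 (i : ℕ)) (annih_le_annih (by lia : n ≤ n + 1) hi)
    rwa [mul_inv_cancel_left] at this

theorem pairwise_disjoint_pow_smul_annih [Fact p.Prime] {n : ℤ} {r : Dual p} (hr : r ∈ shell p n) :
    Pairwise (Function.onFun Disjoint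
      fun i : Fin p => r ^ (i : ℕ) • (annih p n : Set (Dual p))) := by
  intro i j hij
  rw [Function.onFun, Set.disjoint_left]
  intro χ hi hj
  simp only [Set.mem_smul_set_iff_inv_smul_mem, smul_eq_mul, SetLike.mem_coe] at hi hj
  have h1 := mem_annih.1 hi _ (single_mem_chain le_rfl 1)
  have h2 := mem_annih.1 hj _ (single_mem_chain le_rfl 1)
  rw [pairing_mul, ← conj_pairing, pairing_pow] at h1 h2
  refine hij (Fin.ext ((isPrimitiveRoot_pairing hr).pow_inj i.2 j.2 ?_))
  have h3 := mul_right_cancel₀ (pairing_ne_zero _ _) (h1.trans h2.symm)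
  exact (starRingEnd ℂ).injective h3

/-! ### Dilations of characters -/

theorem dualDil_mul (n : ℤ) (χ η : Dual p) : dualDil n (χ * η) = dualDil n χ * dualDil n η := rfl

theorem dil_dil (n m : ℤ) (x : Vilenkin p) : dil n (dil m x) = dil (n + m) x := by
  ext k
  simp [add_assoc]

theorem dil_zero (x : Vilenkin p) : dil 0 x = x := by
  ext k
  simp

theorem dualDil_dualDil (n m : ℤ) (χ : Dual p) : dualDil n (dualDil m χ) = dualDil (n + m) χ := by
  refine dual_ext fun x => ?_
  rw [pairing_dualDil, pairing_dualDil, pairing_dualDil, dil_dil, add_comm]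

theorem dualDil_zero (χ : Dual p) : dualDil 0 χ = χ := by
  refine dual_ext fun x => ?_
  rw [pairing_dualDil, dil_zero]

theorem dil_mem_chain {n k : ℤ} {x : Vilenkin p} : dil n x ∈ chain p k ↔ x ∈ chain p (k + n) := by
  constructor
  · intro h j hj
    have := h (j - n) (by lia)
    rwa [coord_dil, sub_add_cancel] at this
  · intro h j hj
    exact h (j + n) (by lia)

theorem dualDil_mem_annih {n k : ℤ} {χ : Dual p} (h : χ ∈ annih p k) :
    dualDil n χ ∈ annih p (k + n) :=
  fun _ hx => h _ (dil_mem_chain.2 hx)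

theorem dualDil_mem_annih_iff {n k : ℤ} {χ : Dual p} :
    dualDil n χ ∈ annih p (k + n) ↔ χ ∈ annih p k := by
  refine ⟨fun h => ?_, dualDil_mem_annih⟩
  have := dualDil_mem_annih (n := -n) h
  rwa [dualDil_dualDil, neg_add_cancel, dualDil_zero, add_neg_cancel_right] at this

theorem dualDil_mem_shell_iff {n k : ℤ} {χ : Dual p} :
    dualDil n χ ∈ shell p (k + n) ↔ χ ∈ shell p k := by
  simp only [shell, Set.mem_sdiff, SetLike.mem_coe, dualDil_mem_annih_iff]
  rw [add_right_comm, dualDil_mem_annih_iff]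

theorem dualDil_image_image (n m : ℤ) (S : Set (Dual p)) :
    dualDil n '' (dualDil m '' S) = dualDil (n + m) '' S := by
  rw [Set.image_image]
  simp only [dualDil_dualDil]

theorem dualDil_image_smul_annih (n k : ℤ) (ξ : Dual p) :
    dualDil n '' (ξ • (annih p k : Set (Dual p))) =
      dualDil n ξ • (annih p (k + n) : Set (Dual p)) := by
  ext χ
  simp only [Set.mem_image, Set.mem_smul_set, smul_eq_mul, SetLike.mem_coe]
  constructor
  · rintro ⟨_, ⟨η, hη, rfl⟩, rfl⟩
    exact ⟨dualDil n η, dualDil_mem_annih hη, rfl⟩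
  · rintro ⟨η, hη, rfl⟩
    refine ⟨ξ * dualDil (-n) η, ⟨_, ?_, rfl⟩, ?_⟩
    · have := dualDil_mem_annih (n := -n) hη
      rwa [add_neg_cancel_right] at this
    · rw [dualDil_mul, dualDil_dualDil, add_neg_cancel, dualDil_zero]

end Characters

/-! ### Haar measure of annihilators and orthogonality on `X` -/

section DualHaar

variable {p : ℕ} [Fact p.Prime] {ν : Measure (Dual p)} [ν.IsHaarMeasure]

omit [Fact p.Prime] in
theorem measurableSet_smul_annih (ξ : Dual p) (k : ℤ) :
    MeasurableSet (ξ • (annih p k : Set (Dual p))) :=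
  (measurableSet_annih k).const_smul ξ

theorem measure_annih_succ {n : ℤ} {r : Dual p} (hr : r ∈ shell p n) :
    ν (annih p (n + 1) : Set (Dual p)) = p * ν (annih p n : Set (Dual p)) := by
  rw [annih_succ_eq_iUnion hr, measure_iUnion (pairwise_disjoint_pow_smul_annih hr)
    (fun i => measurableSet_smul_annih _ _), tsum_fintype]
  simp [measure_smul]

theorem measure_annih (hν : ν (annih p 0 : Set (Dual p)) = 1) {r : ℤ → Dual p}
    (hr : ∀ n, r n ∈ shell p n) (k : ℤ) : ν (annih p k : Set (Dual p)) = (p : ℝ≥0∞) ^ k := by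
  have hp0 : (p : ℝ≥0∞) ≠ 0 := by simpa using NeZero.ne p
  have hpt : (p : ℝ≥0∞) ≠ ∞ := ENNReal.natCast_ne_top p
  have hmul : ∀ n : ℤ, (p : ℝ≥0∞) * (p : ℝ≥0∞) ^ n = (p : ℝ≥0∞) ^ (1 + n) := fun n => by
    rw [ENNReal.zpow_add hp0 hpt, zpow_one]
  induction k using Int.induction_on with
  | zero => simpa using hν
  | succ k ih => rw [measure_annih_succ (hr _), ih, hmul, add_comm]
  | pred k ih =>
    have h := measure_annih_succ (ν := ν) (hr (-(k : ℤ) - 1))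
    rw [sub_add_cancel, ih, show (p : ℝ≥0∞) ^ (-(k : ℤ)) = p * (p : ℝ≥0∞) ^ (-(k : ℤ) - 1) by
      rw [hmul]; congr 1; ring] at h
    exact ((ENNReal.mul_right_inj hp0 hpt).1 h).symm

theorem measureReal_annih (hν : ν (annih p 0 : Set (Dual p)) = 1) {r : ℤ → Dual p}
    (hr : ∀ n, r n ∈ shell p n) (k : ℤ) : ν.real (annih p k : Set (Dual p)) = (p : ℝ) ^ k := by
  rw [Measure.real, measure_annih hν hr, ENNReal.toReal_natCast_zpow]

theorem measure_smul_annih_lt_top (hν : ν (annih p 0 : Set (Dual p)) = 1) {r : ℤ → Dual p}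
    (hr : ∀ n, r n ∈ shell p n) (ξ : Dual p) (k : ℤ) :
    ν (ξ • (annih p k : Set (Dual p))) < ∞ := by
  rw [measure_smul, measure_annih hν hr]
  exact ENNReal.zpow_lt_top (by simpa using NeZero.ne p) (ENNReal.natCast_ne_top p) _

/-- The trivial character is the only point outside all shells; being null, it can be ignored in the
tiling argument. -/
theorem measure_singleton_one (hν : ν (annih p 0 : Set (Dual p)) = 1) {r : ℤ → Dual p}
    (hr : ∀ n, r n ∈ shell p n) : ν {1} = 0 := by
  have h : ∀ n : ℕ, ν {1} ≤ ((p : ℝ≥0∞)⁻¹) ^ n := fun n => by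
    refine (measure_mono (t := (annih p (-(n : ℤ)) : Set (Dual p))) ?_).trans ?_
    · simp [one_mem]
    · rw [measure_annih hν hr, ENNReal.zpow_neg, zpow_natCast, ENNReal.inv_pow]
  refine le_antisymm (ge_of_tendsto' (ENNReal.tendsto_pow_atTop_nhds_zero_of_lt_one ?_) h) zero_le
  rw [ENNReal.inv_lt_one]
  exact_mod_cast (Fact.out : p.Prime).one_lt

/-- Orthogonality of the points of `G`, as characters of `G_k^⊥`. -/
theorem setIntegral_annih_pairing (hν : ν (annih p 0 : Set (Dual p)) = 1) {r : ℤ → Dual p}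
    (hr : ∀ n, r n ∈ shell p n) (k : ℤ) (a : Vilenkin p) :
    ∫ χ in (annih p k : Set (Dual p)), pairing χ a ∂ν =
      (chain p k : Set (Vilenkin p)).indicator (fun _ => (p : ℂ) ^ k) a := by
  by_cases ha : a ∈ chain p k
  · rw [Set.indicator_of_mem ha,
      setIntegral_congr_fun (measurableSet_annih k) (g := fun _ => (1 : ℂ))
        fun χ hχ => mem_annih.1 hχ a ha]
    simp [measureReal_annih hν hr]
  · rw [Set.indicator_of_notMem ha]
    obtain ⟨η, hη, hne⟩ := exists_mem_annih_pairing_ne_one hr ha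
    -- Translation by `η` preserves `G_k^⊥` and multiplies the integrand by a constant different
    -- from `1`, so the integral vanishes.
    have h : ∫ χ in (annih p k : Set (Dual p)), pairing χ a ∂ν =
        pairing η a * ∫ χ in (annih p k : Set (Dual p)), pairing χ a ∂ν := by
      rw [← integral_indicator (measurableSet_annih k), ← integral_const_mul]
      conv_lhs => rw [← integral_mul_left_eq_self _ η]
      refine integral_congr_ae (ae_of_all _ fun χ => ?_)
      classical
      simp only [Set.indicator_apply, SetLike.mem_coe, Subgroup.mul_mem_cancel_left _ hη,
        pairing_mul, mul_ite, mul_zero]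
    have h' : (1 - pairing η a) * ∫ χ in (annih p k : Set (Dual p)), pairing χ a ∂ν = 0 := by
      rw [sub_mul, ← h]; ring
    exact (mul_eq_zero.1 h').resolve_left (sub_ne_zero.2 (Ne.symm hne))

end DualHaar

/-! ### Orthogonality of characters on `G` -/

section Haar

variable {p : ℕ} [NeZero p] {μ : Measure (Vilenkin p)} [μ.IsAddHaarMeasure]

omit [NeZero p] in
theorem setIntegral_ball_eq (b : Vilenkin p) (k : ℤ) (g : Vilenkin p → ℂ) :
    ∫ x in ball b k, g x ∂μ = ∫ x in (chain p k : Set (Vilenkin p)), g (b + x) ∂μ := by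
  rw [← integral_indicator (measurableSet_ball b k), ← integral_indicator (measurableSet_chain k),
    ← integral_add_left_eq_self _ b]
  refine integral_congr_ae (ae_of_all _ fun x => ?_)
  classical
  simp [Set.indicator_apply, mem_ball]

/-- Orthogonality of characters on balls. -/
theorem setIntegral_ball_pairing (hμ : μ (chain p 0 : Set (Vilenkin p)) = 1) (b : Vilenkin p)
    (k : ℤ) (ξ : Dual p) :
    ∫ x in ball b k, pairing ξ x ∂μ =
      (annih p k : Set (Dual p)).indicator (fun ξ => (p : ℂ) ^ (-k) * pairing ξ b) ξ := by
  rw [setIntegral_ball_eq]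
  simp only [pairing_add]
  rw [integral_const_mul]
  by_cases hξ : ξ ∈ annih p k
  · rw [Set.indicator_of_mem hξ,
      setIntegral_congr_fun (measurableSet_chain k) (g := fun _ => (1 : ℂ))
        fun x hx => mem_annih.1 hξ x hx]
    simp only [integral_const, measureReal_restrict_apply_univ, ← ball_zero, measureReal_ball hμ]
    rw [Complex.real_smul, mul_one, mul_comm]
    push_cast
    rfl
  · rw [Set.indicator_of_notMem hξ]
    have hξ' : ∃ y ∈ chain p k, pairing ξ y ≠ 1 := by
      by_contra! hc
      exact hξ (mem_annih.2 hc)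
    obtain ⟨y, hy, hne⟩ := hξ'
    have h : ∫ x in (chain p k : Set (Vilenkin p)), pairing ξ x ∂μ =
        pairing ξ y * ∫ x in (chain p k : Set (Vilenkin p)), pairing ξ x ∂μ := by
      rw [← ball_zero, ← ball_eq_of_mem (a := 0) (b := y) (k := k) (by rwa [ball_zero])]
      conv_lhs => rw [setIntegral_ball_eq]
      simp only [pairing_add]
      rw [integral_const_mul, ← ball_zero, ← ball_eq_of_mem (a := 0) (b := y) (k := k)
        (by rwa [ball_zero])]
    have h' : (1 - pairing ξ y) *
        ∫ x in (chain p k : Set (Vilenkin p)), pairing ξ x ∂μ = 0 := by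
      rw [sub_mul, ← h]; ring
    rw [(mul_eq_zero.1 h').resolve_left (sub_ne_zero.2 (Ne.symm hne)), mul_zero]

end Haar
end VilenkinFrame
end

/-! ### Isometries from Gram matrices and restriction operators on `L₂` -/

noncomputable section
/-- Two families with the same Gram matrix, the first of which is total, are related by a linear
isometry. -/
theorem exists_linearIsometry_of_inner_eq {ι H K : Type*} [NormedAddCommGroup H]
    [InnerProductSpace ℂ H] [NormedAddCommGroup K] [InnerProductSpace ℂ K] [CompleteSpace K]
    (u : ι → H) (v : ι → K) (hu : (Submodule.span ℂ (Set.range u)).topologicalClosure = ⊤)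
    (huv : ∀ i j, inner ℂ (v i) (v j) = inner ℂ (u i) (u j)) :
    ∃ L : H →ₗᵢ[ℂ] K, ∀ i, L (u i) = v i := by
  set U := Finsupp.linearCombination ℂ u
  set V := Finsupp.linearCombination ℂ v
  have hnorm : ∀ c, ‖V c‖ = ‖U c‖ := fun c => by
    have h : inner ℂ (V c) (V c) = inner ℂ (U c) (U c) := by
      simp only [U, V, Finsupp.linearCombination_apply, Finsupp.sum_inner, Finsupp.inner_sum,
        inner_smul_left, inner_smul_right, huv]
    rw [@norm_eq_sqrt_re_inner ℂ, h, ← @norm_eq_sqrt_re_inner ℂ]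
  have hdense : DenseRange U := by
    rw [DenseRange, dense_iff_closure_eq, ← LinearMap.coe_range,
      Finsupp.range_linearCombination, ← Submodule.topologicalClosure_coe, hu, Submodule.top_coe]
  have hle : ∀ c, ‖V c‖ ≤ 1 * ‖U c‖ := fun c => by rw [one_mul, hnorm]
  have hext := LinearMap.extendOfNorm_eq hdense ⟨1, hle⟩
  refine ⟨⟨(V.extendOfNorm U).toLinearMap, fun x => ?_⟩, fun i => ?_⟩
  · refine hdense.induction_on (p := fun x => ‖V.extendOfNorm U x‖ = ‖x‖) x
      (isClosed_eq (by fun_prop) continuous_norm) fun c => ?_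
    rw [hext, hnorm]
  · have h := hext (Finsupp.single i 1)
    simp only [U, V, Finsupp.linearCombination_single, one_smul] at h
    exact h

namespace MeasureTheory

variable {Y : Type*} [MeasurableSpace Y] {m : Measure Y}

/-- Multiplication by the indicator of a measurable set, on `L₂`. -/
def indicatorL2 (m : Measure Y) {s : Set Y} (hs : MeasurableSet s) : Lp ℂ 2 m →L[ℂ] Lp ℂ 2 m :=
  LinearMap.mkContinuous
    { toFun := fun f => ((Lp.memLp f).indicator hs).toLp (s.indicator f)
      map_add' := fun f g => by
        rw [← MemLp.toLp_add]
        refine MemLp.toLp_congr _ _ ?_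
        filter_upwards [Lp.coeFn_add f g] with x hx
        by_cases h : x ∈ s <;>
          simp only [h, hx, Pi.add_apply, Set.indicator_of_mem, not_false_eq_true,
            Set.indicator_of_notMem, add_zero]
      map_smul' := fun c f => by
        rw [RingHom.id_apply, ← MemLp.toLp_const_smul]
        refine MemLp.toLp_congr _ _ ?_
        filter_upwards [Lp.coeFn_smul c f] with x hx
        by_cases h : x ∈ s <;>
          simp only [h, hx, Pi.smul_apply, Set.indicator_of_mem, not_false_eq_true,
            Set.indicator_of_notMem, smul_zero] } 1 fun f => by
    rw [one_mul, LinearMap.coe_mk, AddHom.coe_mk, Lp.norm_toLp, Lp.norm_def]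
    exact ENNReal.toReal_mono (Lp.eLpNorm_ne_top f) (eLpNorm_indicator_le _)

theorem indicatorL2_apply {s : Set Y} (hs : MeasurableSet s) (f : Lp ℂ 2 m) :
    indicatorL2 m hs f = ((Lp.memLp f).indicator hs).toLp (s.indicator f) := rfl

theorem coeFn_indicatorL2 {s : Set Y} (hs : MeasurableSet s) (f : Lp ℂ 2 m) :
    indicatorL2 m hs f =ᵐ[m] s.indicator f := by
  rw [indicatorL2_apply]
  exact MemLp.coeFn_toLp _

theorem indicatorL2_eq_zero_iff {s : Set Y} (hs : MeasurableSet s) (f : Lp ℂ 2 m) :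
    indicatorL2 m hs f = 0 ↔ ∀ᵐ x ∂m, x ∈ s → f x = 0 := by
  rw [Lp.eq_zero_iff_ae_eq_zero]
  constructor
  · intro h
    filter_upwards [h, coeFn_indicatorL2 hs f] with x h1 h2 hx
    rw [h2, Set.indicator_of_mem hx] at h1
    exact h1
  · intro h
    filter_upwards [h, coeFn_indicatorL2 hs f] with x h1 h2
    rw [h2]
    exact Set.indicator_apply_eq_zero.2 h1

theorem indicatorL2_toLp {s : Set Y} (hs : MeasurableSet s) {f : Y → ℂ} (hf : MemLp f 2 m) :
    indicatorL2 m hs (hf.toLp f) = (hf.indicator hs).toLp _ := by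
  rw [indicatorL2_apply]
  refine MemLp.toLp_congr _ _ ?_
  filter_upwards [hf.coeFn_toLp] with x hx
  by_cases h : x ∈ s <;> simp [h, hx]

end MeasureTheory

namespace VilenkinFrame

/-! ### Characters cut off to balls -/

section Atoms

variable {p : ℕ} [NeZero p] {μ : Measure (Vilenkin p)} [μ.IsAddHaarMeasure]

/-- The character `ξ` restricted to the ball `b + G_k`. -/
def atom (ξ : Dual p) (b : Vilenkin p) (k : ℤ) : Vilenkin p → ℂ := (ball b k).indicator (pairing ξ)

theorem memLp_atom (hμ : μ (chain p 0 : Set (Vilenkin p)) = 1) (ξ : Dual p) (b : Vilenkin p)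
    (k : ℤ) : MemLp (atom ξ b k) 2 μ := by
  refine (memLp_indicator_iff_restrict (measurableSet_ball b k)).2 ?_
  have : IsFiniteMeasure (μ.restrict (ball b k)) :=
    ⟨by rw [Measure.restrict_apply_univ]; exact measure_ball_lt_top hμ _ _⟩
  exact MemLp.of_bound (continuous_pairing ξ).aestronglyMeasurable 1
    (ae_of_all _ fun x => (norm_pairing ξ x).le)

/-- `atom ξ b k` as an element of `L₂(G)`. -/
def atomLp (hμ : μ (chain p 0 : Set (Vilenkin p)) = 1) (ξ : Dual p) (b : Vilenkin p) (k : ℤ) :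
    Lp ℂ 2 μ := (memLp_atom hμ ξ b k).toLp _

theorem inner_atomLp (hμ : μ (chain p 0 : Set (Vilenkin p)) = 1) (ξ : Dual p) (b : Vilenkin p)
    (k : ℤ) (F : Lp ℂ 2 μ) :
    inner ℂ (atomLp hμ ξ b k) F = ∫ x in ball b k, F x * conj (pairing ξ x) ∂μ := by
  rw [L2.inner_def, ← integral_indicator (measurableSet_ball b k)]
  refine integral_congr_ae ?_
  filter_upwards [(memLp_atom hμ ξ b k).coeFn_toLp] with x hx
  rw [atomLp, hx, RCLike.inner_apply, atom]
  by_cases h : x ∈ ball b k <;> simp [h]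

theorem inner_atomLp_toLp (hμ : μ (chain p 0 : Set (Vilenkin p)) = 1) (ξ : Dual p)
    (b : Vilenkin p) (k : ℤ) {f : Vilenkin p → ℂ} (hf : MemLp f 2 μ) :
    inner ℂ (atomLp hμ ξ b k) (hf.toLp f) = ∫ x in ball b k, f x * conj (pairing ξ x) ∂μ := by
  rw [inner_atomLp]
  refine integral_congr_ae (ae_restrict_of_ae ?_)
  filter_upwards [hf.coeFn_toLp] with x hx
  rw [hx]

theorem inner_atomLp_one (hμ : μ (chain p 0 : Set (Vilenkin p)) = 1) {a b : Vilenkin p}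
    {k m : ℤ} (h : k ≤ m) :
    inner ℂ (atomLp hμ 1 a k) (atomLp hμ 1 b m) =
      (ball a k).indicator (fun _ => (p : ℂ) ^ (-m)) b := by
  rw [atomLp.eq_1 hμ 1 b m, inner_atomLp_toLp]
  simp only [pairing_one, map_one, mul_one, atom]
  rw [setIntegral_indicator (measurableSet_ball b m)]
  simp only [pairing_one, integral_const, measureReal_restrict_apply_univ, Complex.real_smul,
    mul_one]
  classical
  rw [ball_inter_eq h]
  by_cases hb : b ∈ ball a k
  · rw [if_pos hb, measureReal_ball hμ, Set.indicator_of_mem hb]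
    push_cast
    rfl
  · simp [hb]

/-- A vector orthogonal to all indicators of balls has vanishing integral over every ball, hence is
zero. -/
theorem span_atomLp_one (hμ : μ (chain p 0 : Set (Vilenkin p)) = 1) :
    (Submodule.span ℂ (Set.range fun i : Vilenkin p × ℤ =>
      atomLp hμ 1 i.1 i.2)).topologicalClosure = ⊤ := by
  rw [Submodule.topologicalClosure_eq_top_iff, Submodule.eq_bot_iff]
  intro F hF
  rw [Lp.eq_zero_iff_ae_eq_zero]
  refine ae_eq_zero_of_forall_setIntegral_ball hμ (Lp.memLp F) fun a k => ?_
  have := (Submodule.mem_orthogonal _ F).1 hF _ (Submodule.subset_span ⟨(a, k), rfl⟩)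
  rw [inner_atomLp] at this
  simpa [pairing_one] using this

end Atoms

/-! ### The Plancherel isometry -/

section Plancherel

variable {p : ℕ} [Fact p.Prime] {μ : Measure (Vilenkin p)} [μ.IsAddHaarMeasure]
  {ν : Measure (Dual p)} [ν.IsHaarMeasure]

/-- The Fourier transform of the indicator of `b + G_k`. -/
def dualAtom (b : Vilenkin p) (k : ℤ) : Dual p → ℂ :=
  (annih p k : Set (Dual p)).indicator fun χ => (p : ℂ) ^ (-k) * conj (pairing χ b)

omit [Fact p.Prime] in
theorem setIntegral_ball_conj_pairing [NeZero p]
    (hμ : μ (chain p 0 : Set (Vilenkin p)) = 1) (b : Vilenkin p)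
    (k : ℤ) (χ : Dual p) : ∫ x in ball b k, conj (pairing χ x) ∂μ = dualAtom b k χ := by
  simp only [conj_pairing]
  rw [setIntegral_ball_pairing hμ, dualAtom]
  by_cases h : χ ∈ annih p k
  · rw [Set.indicator_of_mem (by exact inv_mem h), Set.indicator_of_mem (by exact h),
      conj_pairing]
  · rw [Set.indicator_of_notMem (fun h' => h (by simpa using inv_mem h')),
      Set.indicator_of_notMem (by exact h)]

theorem memLp_dualAtom (hν : ν (annih p 0 : Set (Dual p)) = 1) {r : ℤ → Dual p}
    (hr : ∀ n, r n ∈ shell p n) (b : Vilenkin p) (k : ℤ) : MemLp (dualAtom b k) 2 ν := by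
  refine (memLp_indicator_iff_restrict (measurableSet_annih k)).2 ?_
  have : IsFiniteMeasure (ν.restrict (annih p k : Set (Dual p))) :=
    ⟨by
      rw [Measure.restrict_apply_univ, ← one_smul (Dual p) (annih p k : Set (Dual p))]
      exact measure_smul_annih_lt_top hν hr _ _⟩
  refine MemLp.of_bound (C := ‖(p : ℂ) ^ (-k)‖) ?_ (ae_of_all _ fun χ => ?_)
  · exact (continuous_const.mul (Complex.continuous_conj.comp
      (continuous_pairing_left b))).measurable.aestronglyMeasurable
  · rw [norm_mul, RCLike.norm_conj, norm_pairing, mul_one]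

/-- The supports are nested, so the product is `p^{-k-m} (χ, a - b)` on `G_k^⊥`, and orthogonality
contributes `p^k` or `0`. The result is the Gram matrix of `inner_atomLp_one`. -/
theorem inner_dualAtom (hν : ν (annih p 0 : Set (Dual p)) = 1) {r : ℤ → Dual p}
    (hr : ∀ n, r n ∈ shell p n) {a b : Vilenkin p} {k m : ℤ} (h : k ≤ m) :
    inner ℂ ((memLp_dualAtom hν hr a k).toLp _) ((memLp_dualAtom hν hr b m).toLp _) =
      (ball a k).indicator (fun _ => (p : ℂ) ^ (-m)) b := by
  have hp : (p : ℂ) ≠ 0 := by simpa using NeZero.ne p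
  have h1 : inner ℂ ((memLp_dualAtom hν hr a k).toLp _) ((memLp_dualAtom hν hr b m).toLp _) =
      ∫ χ in (annih p k : Set (Dual p)), (p : ℂ) ^ (-k) * (p : ℂ) ^ (-m) * pairing χ (a - b) ∂ν := by
    rw [L2.inner_def, ← integral_indicator (measurableSet_annih k)]
    refine integral_congr_ae ?_
    filter_upwards [(memLp_dualAtom hν hr a k).coeFn_toLp,
      (memLp_dualAtom hν hr b m).coeFn_toLp] with χ h2 h3
    rw [h2, h3, RCLike.inner_apply, dualAtom, dualAtom]
    by_cases hχ : χ ∈ annih p k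
    · have hχ' := annih_le_annih h hχ
      simp only [SetLike.mem_coe, hχ, hχ', Set.indicator_of_mem, map_mul, Complex.conj_conj,
        pairing_sub, map_zpow₀, Complex.conj_natCast]
      ring
    · simp [hχ]
  rw [h1, integral_const_mul, setIntegral_annih_pairing hν hr]
  have hiff : a - b ∈ chain p k ↔ b ∈ ball a k := by
    rw [mem_ball, ← neg_mem_iff, neg_sub]
  by_cases hb : b ∈ ball a k
  · rw [Set.indicator_of_mem hb, Set.indicator_of_mem (by exact hiff.2 hb), mul_right_comm,
      ← zpow_add₀ hp, neg_add_cancel, zpow_zero, one_mul]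
  · rw [Set.indicator_of_notMem hb, Set.indicator_of_notMem (fun h' => hb (hiff.1 h')), mul_zero]

theorem exists_fourier (hμ : μ (chain p 0 : Set (Vilenkin p)) = 1)
    (hν : ν (annih p 0 : Set (Dual p)) = 1) {r : ℤ → Dual p} (hr : ∀ n, r n ∈ shell p n) :
    ∃ L : Lp ℂ 2 μ →ₗᵢ[ℂ] Lp ℂ 2 ν, ∀ b k, L (atomLp hμ 1 b k) =ᵐ[ν] dualAtom b k := by
  obtain ⟨L, hL⟩ := exists_linearIsometry_of_inner_eq
    (fun i : Vilenkin p × ℤ => atomLp hμ 1 i.1 i.2)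
    (fun i => (memLp_dualAtom hν hr i.1 i.2).toLp _) (span_atomLp_one hμ) (fun i j => by
      rcases le_total i.2 j.2 with h | h
      · rw [inner_dualAtom hν hr h, inner_atomLp_one hμ h]
      · rw [← inner_conj_symm, inner_dualAtom hν hr h, ← inner_atomLp_one hμ h,
          inner_conj_symm])
  refine ⟨L, fun b k => ?_⟩
  rw [hL (b, k)]
  exact MemLp.coeFn_toLp _

end Plancherel
end VilenkinFrame
end

/-! ### The isometry agrees with the limit of truncated Fourier integrals -/

noncomputable section
namespace MeasureTheory

variable {Y : Type*} [MeasurableSpace Y] {m : Measure Y}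

theorem enorm_sub_toLp_eq {f : Y → ℂ} {F : Lp ℂ 2 m} (G : Lp ℂ 2 m) (hf : f =ᵐ[m] F) :
    eLpNorm (fun x => f x - G x) 2 m = ‖F - G‖ₑ := by
  rw [Lp.enorm_def]
  refine eLpNorm_congr_ae ?_
  filter_upwards [hf, Lp.coeFn_sub F G] with x h1 h2
  rw [h1, h2, Pi.sub_apply]

/-- Restrictions to sets which exhaust the space converge in `L₂`. -/
theorem tendsto_indicatorL2 {s : ℕ → Set Y} (hs : ∀ n, MeasurableSet (s n))
    (hx : ∀ x, ∀ᶠ n in atTop, x ∈ s n) (F : Lp ℂ 2 m) :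
    Tendsto (fun n => indicatorL2 m (hs n) F) atTop (𝓝 F) := by
  rw [Lp.tendsto_Lp_iff_tendsto_eLpNorm']
  have h2 : ∀ n, eLpNorm (⇑(indicatorL2 m (hs n) F) - ⇑F) 2 m =
      (∫⁻ x, (s n)ᶜ.indicator (fun x => ‖F x‖ₑ ^ (2 : ℝ)) x ∂m) ^ ((1 : ℝ) / 2) := by
    intro n
    rw [eLpNorm_eq_lintegral_rpow_enorm_toReal (by norm_num) (by norm_num), ENNReal.toReal_ofNat]
    congr 1
    refine lintegral_congr_ae ?_
    filter_upwards [coeFn_indicatorL2 (hs n) F] with x hx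
    rw [Pi.sub_apply, hx]
    by_cases h : x ∈ s n <;> simp [h]
  simp only [h2]
  have hfin : ∫⁻ x, ‖F x‖ₑ ^ (2 : ℝ) ∂m ≠ ∞ := by
    have := lintegral_rpow_enorm_lt_top_of_eLpNorm_lt_top (p := 2) (by norm_num) (by norm_num)
      (Lp.eLpNorm_lt_top F)
    simpa using this.ne
  have h3 := tendsto_lintegral_of_dominated_convergence' (μ := m)
    (F := fun n x => (s n)ᶜ.indicator (fun x => ‖F x‖ₑ ^ (2 : ℝ)) x) (f := fun _ => 0)
    (fun x => ‖F x‖ₑ ^ (2 : ℝ))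
    (fun n => (((Lp.aestronglyMeasurable F).enorm).pow_const _).indicator (hs n).compl)
    (fun n => ae_of_all _ fun x => Set.indicator_le_self _ _ x) hfin
    (ae_of_all _ fun x => tendsto_const_nhds.congr' (by
      filter_upwards [hx x] with n hn
      simp [hn]))
  have h4 := ((ENNReal.continuous_rpow_const (y := (1 : ℝ) / 2)).tendsto _).comp h3
  simpa [Function.comp_def] using h4

end MeasureTheory

namespace VilenkinFrame

variable {p : ℕ} [Fact p.Prime] {μ : Measure (Vilenkin p)} [μ.IsAddHaarMeasure]
  {ν : Measure (Dual p)}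

/-- Truncating the indicator of a ball to `G_n` gives zero or the indicator of a ball again, so
truncation stays inside the family on which `L` is known explicitly. -/
theorem indicatorL2_atomLp_one (hμ : μ (chain p 0 : Set (Vilenkin p)) = 1) (n : ℤ)
    (b : Vilenkin p) (k : ℤ) :
    (indicatorL2 μ (measurableSet_chain n) (atomLp hμ 1 b k) = 0 ∧
      ∀ χ : Dual p, inner ℂ (atomLp hμ χ 0 n) (atomLp hμ 1 b k) = 0) ∨
    ∃ c m, indicatorL2 μ (measurableSet_chain n) (atomLp hμ 1 b k) = atomLp hμ 1 c m ∧
      ∀ χ : Dual p, inner ℂ (atomLp hμ χ 0 n) (atomLp hμ 1 b k) =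
        ∫ x in ball c m, conj (pairing χ x) ∂μ := by
  have hin : ∀ χ : Dual p, inner ℂ (atomLp hμ χ 0 n) (atomLp hμ 1 b k) =
      ∫ x in ball 0 n ∩ ball b k, conj (pairing χ x) ∂μ := fun χ => by
    rw [atomLp.eq_1 hμ 1, inner_atomLp_toLp, ← setIntegral_indicator (measurableSet_ball b k)]
    congr 1
    ext x
    by_cases h : x ∈ ball b k <;> simp [atom, h, pairing_one]
  have hind : indicatorL2 μ (measurableSet_chain n) (atomLp hμ 1 b k) =
      ((memLp_atom hμ 1 b k).indicator (measurableSet_chain n)).toLp _ :=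
    indicatorL2_toLp _ _
  have hfun : (chain p n : Set (Vilenkin p)).indicator (atom (1 : Dual p) b k) =
      (ball 0 n ∩ ball b k).indicator (pairing 1) := by
    rw [atom, Set.indicator_indicator, ball_zero]
  rcases ball_inter_ball 0 b n k with h | ⟨c, m, h⟩
  · left
    refine ⟨?_, fun χ => by rw [hin, h]; simp⟩
    rw [hind, Lp.eq_zero_iff_ae_eq_zero]
    refine (MemLp.coeFn_toLp _).trans (ae_of_all _ fun x => ?_)
    rw [hfun, h, Set.indicator_empty]
    rfl
  · right
    refine ⟨c, m, ?_, fun χ => by rw [hin, h]⟩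
    rw [hind, atomLp]
    refine MemLp.toLp_congr _ _ (ae_of_all _ fun x => ?_)
    rw [hfun, h, atom]

/-- The Fourier integral over `G_n` computes the Plancherel transform. -/
theorem inner_atomLp_ae_eq (hμ : μ (chain p 0 : Set (Vilenkin p)) = 1)
    {L : Lp ℂ 2 μ →ₗᵢ[ℂ] Lp ℂ 2 ν}
    (hL : ∀ b k, L (atomLp hμ 1 b k) =ᵐ[ν] dualAtom b k) (n : ℤ) (F : Lp ℂ 2 μ) :
    (fun χ => inner ℂ (atomLp hμ χ 0 n) F) =ᵐ[ν] L (indicatorL2 μ (measurableSet_chain n) F) := by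
  set P := indicatorL2 μ (measurableSet_chain (p := p) n)
  have hspan : ∀ F ∈ Submodule.span ℂ (Set.range fun i : Vilenkin p × ℤ => atomLp hμ 1 i.1 i.2),
      (fun χ => inner ℂ (atomLp hμ χ 0 n) F) =ᵐ[ν] L (P F) := by
    intro F hF
    induction hF using Submodule.span_induction with
    | mem F hF =>
      obtain ⟨⟨b, k⟩, rfl⟩ := hF
      rcases indicatorL2_atomLp_one hμ n b k with ⟨h1, h2⟩ | ⟨c, m, h1, h2⟩
      · simp only [P, h1, h2, map_zero]
        exact (Lp.coeFn_zero ℂ 2 ν).symm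
      · simp only [P, h1, h2, setIntegral_ball_conj_pairing hμ]
        exact (hL c m).symm
    | zero =>
      simp only [inner_zero_right, map_zero]
      exact (Lp.coeFn_zero ℂ 2 ν).symm
    | add F G _ _ hF hG =>
      rw [map_add, map_add]
      filter_upwards [hF, hG, Lp.coeFn_add (L (P F)) (L (P G))] with χ h1 h2 h3
      rw [h3, inner_add_right, Pi.add_apply, ← h1, ← h2]
    | smul c F _ hF =>
      rw [map_smul, map_smul]
      filter_upwards [hF, Lp.coeFn_smul c (L (P F))] with χ h1 h2
      rw [h2, inner_smul_right, Pi.smul_apply, ← h1, smul_eq_mul]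
  have hF : F ∈ closure (Submodule.span ℂ (Set.range fun i : Vilenkin p × ℤ =>
      atomLp hμ 1 i.1 i.2) : Set (Lp ℂ 2 μ)) := by
    rw [← Submodule.topologicalClosure_coe, span_atomLp_one hμ]
    trivial
  obtain ⟨u, hu, hlim⟩ := mem_closure_iff_seq_limit.1 hF
  have hlim' : Tendsto (fun i => L (P (u i))) atTop (𝓝 (L (P F))) :=
    ((L.continuous.comp P.continuous).tendsto F).comp hlim
  -- For each fixed `χ` the left side is continuous in `F`, whereas the right side converges only in
  -- `L₂`; an almost everywhere convergent subsequence identifies the two limits.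
  obtain ⟨ns, hns, hae⟩ := (tendstoInMeasure_of_tendsto_Lp hlim').exists_seq_tendsto_ae
  filter_upwards [hae, ae_all_iff.2 fun i => hspan _ (hu i)] with χ h1 h2
  refine tendsto_nhds_unique ?_ h1
  simp only [← h2]
  exact (((innerSL ℂ (atomLp hμ χ 0 n)).continuous.tendsto F).comp hlim).comp hns.tendsto_atTop

theorem eLpNorm_fourierIntegral_sub (hμ : μ (chain p 0 : Set (Vilenkin p)) = 1)
    {L : Lp ℂ 2 μ →ₗᵢ[ℂ] Lp ℂ 2 ν}
    (hL : ∀ b k, L (atomLp hμ 1 b k) =ᵐ[ν] dualAtom b k) {f : Vilenkin p → ℂ} (hf : MemLp f 2 μ)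
    (n : ℤ) :
    eLpNorm (fun χ => (∫ x in (chain p n : Set (Vilenkin p)), f x * conj (pairing χ x) ∂μ) -
      L (hf.toLp f) χ) 2 ν =
      ‖indicatorL2 μ (measurableSet_chain n) (hf.toLp f) - hf.toLp f‖ₑ := by
  have h : (fun χ => ∫ x in (chain p n : Set (Vilenkin p)), f x * conj (pairing χ x) ∂μ) =ᵐ[ν]
      L (indicatorL2 μ (measurableSet_chain n) (hf.toLp f)) := by
    refine EventuallyEq.trans (ae_of_all _ fun χ => ?_) (inner_atomLp_ae_eq hμ hL n (hf.toLp f))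
    dsimp only
    rw [inner_atomLp_toLp, ball_zero]
  rw [enorm_sub_toLp_eq _ h, ← map_sub, L.enorm_map]

theorem tendsto_eLpNorm_fourierIntegral_sub (hμ : μ (chain p 0 : Set (Vilenkin p)) = 1)
    {L : Lp ℂ 2 μ →ₗᵢ[ℂ] Lp ℂ 2 ν}
    (hL : ∀ b k, L (atomLp hμ 1 b k) =ᵐ[ν] dualAtom b k) {f : Vilenkin p → ℂ}
    (hf : MemLp f 2 μ) :
    Tendsto (fun n : ℕ => eLpNorm (fun χ =>
      (∫ x in (chain p (-(n : ℤ)) : Set (Vilenkin p)), f x * conj (pairing χ x) ∂μ) -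
        L (hf.toLp f) χ) 2 ν) atTop (𝓝 0) := by
  simp only [eLpNorm_fourierIntegral_sub hμ hL hf]
  have h := tendsto_indicatorL2 (m := μ)
    (fun n : ℕ => measurableSet_chain (p := p) (-(n : ℤ))) (fun x => by
      obtain ⟨n, hn⟩ := Set.mem_iUnion.1 (iUnion_chain.ge (Set.mem_univ x))
      filter_upwards [eventually_ge_atTop n] with k hk
      exact chain_le_chain (by lia) hn) (hf.toLp f)
  exact tendsto_iff_enorm_sub_tendsto_zero.1 h

theorem isFourierTransform_plancherel (hμ : μ (chain p 0 : Set (Vilenkin p)) = 1)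
    {L : Lp ℂ 2 μ →ₗᵢ[ℂ] Lp ℂ 2 ν}
    (hL : ∀ b k, L (atomLp hμ 1 b k) =ᵐ[ν] dualAtom b k) {f : Vilenkin p → ℂ}
    (hf : MemLp f 2 μ) : IsFourierTransform μ ν f (L (hf.toLp f)) :=
  ⟨hf, Lp.memLp _, tendsto_eLpNorm_fourierIntegral_sub hμ hL hf⟩

/-- Uniqueness of `L₂` limits: both functions are limits of the same truncated integrals. -/
theorem IsFourierTransform.ae_eq (hμ : μ (chain p 0 : Set (Vilenkin p)) = 1)
    {L : Lp ℂ 2 μ →ₗᵢ[ℂ] Lp ℂ 2 ν}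
    (hL : ∀ b k, L (atomLp hμ 1 b k) =ᵐ[ν] dualAtom b k) {f : Vilenkin p → ℂ} {F : Dual p → ℂ}
    (hf : MemLp f 2 μ) (h : IsFourierTransform μ ν f F) : F =ᵐ[ν] L (hf.toLp f) := by
  set T : ℕ → Dual p → ℂ := fun n χ =>
    ∫ x in (chain p (-(n : ℤ)) : Set (Vilenkin p)), f x * conj (pairing χ x) ∂μ with hT
  have hTm : ∀ n, AEStronglyMeasurable (T n) ν := fun n => by
    refine (Lp.aestronglyMeasurable (L (indicatorL2 μ (measurableSet_chain (-(n : ℤ)))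
      (hf.toLp f)))).congr ?_
    refine (inner_atomLp_ae_eq hμ hL _ (hf.toLp f)).symm.trans (ae_of_all _ fun χ => ?_)
    dsimp only [hT]
    rw [inner_atomLp_toLp, ball_zero]
  have h1 := h.2.2
  have h2 := tendsto_eLpNorm_fourierIntegral_sub hμ hL hf
  have h3 : eLpNorm (F - ⇑(L (hf.toLp f))) 2 ν ≤ 0 := by
    refine ge_of_tendsto' (by simpa using h1.add h2) fun n => ?_
    have h4 : F - ⇑(L (hf.toLp f)) =
        (fun χ => T n χ - L (hf.toLp f) χ) - fun χ => T n χ - F χ := by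
      ext χ
      simp
    rw [h4, add_comm]
    exact eLpNorm_sub_le ((hTm n).sub (Lp.aestronglyMeasurable _))
      ((hTm n).sub h.2.1.aestronglyMeasurable) (by norm_num)
  rw [nonpos_iff_eq_zero, eLpNorm_eq_zero_iff
    (h.2.1.aestronglyMeasurable.sub (Lp.aestronglyMeasurable _)) (by norm_num)] at h3
  filter_upwards [h3] with χ hχ
  exact sub_eq_zero.1 hχ

end VilenkinFrame
end

/-! ### Expansions in orthogonal and nearly orthogonal families -/

noncomputable section
section Hilbert

variable {H : Type*} [NormedAddCommGroup H] [InnerProductSpace ℂ H]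

/-- After normalization the coefficients are `‖w i‖²` times Fourier coefficients of `f`, so Bessel's
inequality bounds them since `‖w i‖ ≤ 1`. -/
theorem summable_inner_smul_of_orthogonal [CompleteSpace H] {I : Type*} {w : I → H}
    (h0 : ∀ i, w i ≠ 0)
    (h1 : ∀ i, ‖w i‖ ≤ 1) (hw : Pairwise fun i j => inner ℂ (w i) (w j) = 0) (f : H) :
    Summable fun i => inner ℂ (w i) f • w i := by
  set e : I → H := fun i => ((‖w i‖ : ℂ)⁻¹) • w i with he
  have hn : ∀ i, (‖w i‖ : ℂ) ≠ 0 := fun i => by simpa using h0 i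
  have hon : Orthonormal ℂ e := by
    refine ⟨fun i => ?_, fun i j hij => ?_⟩
    · rw [he]
      simp only [norm_smul, norm_inv, Complex.norm_real, norm_norm]
      exact inv_mul_cancel₀ (norm_ne_zero_iff.2 (h0 i))
    · rw [he]
      simp only [inner_smul_left, inner_smul_right, hw hij, mul_zero]
  have hterm : ∀ i, inner ℂ (w i) f • w i = ((‖w i‖ : ℂ) ^ 2 * inner ℂ (e i) f) • e i := by
    intro i
    rw [he]
    simp only [inner_smul_left, smul_smul, map_inv₀, Complex.conj_ofReal]
    congr 1
    field_simp [hn i]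
  have hs := (hon.orthogonalFamily.summable_iff_norm_sq_summable
    fun i => (‖w i‖ : ℂ) ^ 2 * inner ℂ (e i) f).2 (by
      refine Summable.of_nonneg_of_le (fun i => by positivity) (fun i => ?_)
        (hon.inner_products_summable f)
      rw [norm_mul, norm_pow, Complex.norm_real, norm_norm]
      have h2 : ‖w i‖ ^ 2 ≤ 1 := pow_le_one₀ (norm_nonneg _) (h1 i)
      gcongr
      exact mul_le_of_le_one_left (norm_nonneg _) h2)
  simpa only [hterm, LinearIsometry.toSpanSingleton_apply] using hs

/-- A family that splits into finitely many orthogonal families of vectors of norm at most one has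
unconditionally convergent expansions. -/
theorem summable_inner_smul_of_coloring [CompleteSpace H] {I K : Type*} [Finite K] {w : I → H}
    (h0 : ∀ i, w i ≠ 0) (h1 : ∀ i, ‖w i‖ ≤ 1) (κ : I → K)
    (hκ : ∀ i j, i ≠ j → κ i = κ j → inner ℂ (w i) (w j) = 0) (f : H) :
    Summable fun i => inner ℂ (w i) f • w i := by
  classical
  cases nonempty_fintype K
  have hdecomp : (fun i => inner ℂ (w i) f • w i) = fun i => ∑ c : K,
      (κ ⁻¹' {c}).indicator (fun i => inner ℂ (w i) f • w i) i := by
    ext i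
    simp [Set.indicator_apply]
  rw [hdecomp]
  refine summable_sum fun c _ => ?_
  rw [← summable_subtype_iff_indicator]
  exact summable_inner_smul_of_orthogonal (w := fun i : κ ⁻¹' {c} => w i) (fun i => h0 i)
    (fun i => h1 i) (fun i j hij => hκ i j (fun h => hij (Subtype.ext h))
      (i.2.trans (Eq.symm j.2))) f

/-- If the term of the index `i` is repeated `‖w i‖⁻²` times in an expansion and all other terms
are orthogonal to it, then the remainder is orthogonal to `w i`. -/
theorem inner_sub_hasSum_eq_zero {I : Type*} {w : I → H} {f g : H}
    (hg : HasSum (fun i => inner ℂ (w i) f • w i) g) (i : I) (A : Finset I)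
    (hA : ∀ j ∈ A, inner ℂ (w j) f • w j = inner ℂ (w i) f • w i)
    (hA' : ∀ j ∉ A, inner ℂ (w i) (w j) = 0) (hcard : (A.card : ℝ) * ‖w i‖ ^ 2 = 1) :
    inner ℂ (w i) (f - g) = 0 := by
  have h1 : HasSum (fun j => inner ℂ (w i) (inner ℂ (w j) f • w j)) (inner ℂ (w i) g) :=
    (innerSL ℂ (w i)).hasSum hg
  have h2 := hasSum_sum_of_ne_finset_zero (s := A) (L := SummationFilter.unconditional I)
    (f := fun j => inner ℂ (w i) (inner ℂ (w j) f • w j)) fun j hj => by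
      rw [inner_smul_right, hA' j hj, mul_zero]
  have h3 : ∑ j ∈ A, inner ℂ (w i) (inner ℂ (w j) f • w j) = inner ℂ (w i) f := by
    rw [Finset.sum_congr rfl fun j hj => by rw [hA j hj], Finset.sum_const, nsmul_eq_mul,
      inner_smul_right, inner_self_eq_norm_sq_to_K]
    have h4 : (A.card : ℂ) * (‖w i‖ : ℂ) ^ 2 = 1 := by exact_mod_cast hcard
    rw [mul_left_comm]
    exact (congrArg _ h4).trans (mul_one _)
  rw [inner_sub_right, h1.unique h2, h3, sub_self]

end Hilbert

namespace MeasureTheory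

variable {Y : Type*} [MeasurableSpace Y] {m : Measure Y}

theorem coeFn_finsetSum_Lp {I : Type*} (S : Finset I) (F : I → Lp ℂ 2 m) :
    ⇑(∑ i ∈ S, F i) =ᵐ[m] fun x => ∑ i ∈ S, F i x := by
  classical
  induction S using Finset.induction_on with
  | empty =>
    simp only [Finset.sum_empty]
    exact Lp.coeFn_zero ℂ 2 m
  | insert i S hi ih =>
    rw [Finset.sum_insert hi]
    filter_upwards [Lp.coeFn_add (F i) (∑ j ∈ S, F j), ih] with x h1 h2
    rw [h1, Pi.add_apply, h2, Finset.sum_insert hi]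

theorem inner_eq_zero_of_disjoint_support {F G : Lp ℂ 2 m} {s t : Set Y} (hst : Disjoint s t)
    (hF : ∀ᵐ x ∂m, x ∉ s → F x = 0) (hG : ∀ᵐ x ∂m, x ∉ t → G x = 0) : inner ℂ F G = 0 := by
  rw [L2.inner_def]
  refine integral_eq_zero_of_ae ?_
  filter_upwards [hF, hG] with x h1 h2
  by_cases h : x ∈ s
  · rw [h2 (Set.disjoint_left.1 hst h), inner_zero_right]
    rfl
  · rw [h1 h, inner_zero_left]
    rfl

end MeasureTheory

namespace VilenkinFrame

/-! ### Fourier transforms of characters cut off to balls -/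

section Modulated

variable {p : ℕ} [Fact p.Prime] {μ : Measure (Vilenkin p)} [μ.IsAddHaarMeasure]
  {ν : Measure (Dual p)}

theorem norm_atomLp_sq (hμ : μ (chain p 0 : Set (Vilenkin p)) = 1) (ξ : Dual p) (b : Vilenkin p)
    (k : ℤ) : ‖atomLp hμ ξ b k‖ ^ 2 = (p : ℝ) ^ (-k) := by
  have h : inner ℂ (atomLp hμ ξ b k) ((memLp_atom hμ ξ b k).toLp _) = (((p : ℝ) ^ (-k) : ℝ) : ℂ) := by
    rw [inner_atomLp_toLp,
      setIntegral_congr_fun (measurableSet_ball b k) (g := fun _ => (1 : ℂ)) fun x hx => by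
        rw [atom, Set.indicator_of_mem hx, mul_comm, conj_pairing_mul_pairing]]
    simp [measureReal_ball hμ]
  rw [← inner_self_eq_norm_sq (𝕜 := ℂ)]
  exact (congrArg RCLike.re h).trans (Complex.ofReal_re _)

theorem atomLp_congr (hμ : μ (chain p 0 : Set (Vilenkin p)) = 1) (ξ : Dual p) {a b : Vilenkin p}
    {k : ℤ} (h : b ∈ ball a k) : atomLp hμ ξ b k = atomLp hμ ξ a k := by
  simp only [atomLp, atom, ball_eq_of_mem h]

theorem inner_atomLp_of_notMem (hμ : μ (chain p 0 : Set (Vilenkin p)) = 1) (ξ η : Dual p)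
    {a b : Vilenkin p} {k : ℤ} (h : b ∉ ball a k) :
    inner ℂ (atomLp hμ ξ a k) (atomLp hμ η b k) = 0 := by
  rw [atomLp.eq_1 hμ η, inner_atomLp_toLp]
  refine setIntegral_eq_zero_of_forall_eq_zero fun x hx => ?_
  rw [atom, Set.indicator_of_notMem (Set.disjoint_left.1 (ball_disjoint h) hx), zero_mul]

/-- Modulation by `ξ` becomes translation by `ξ`. The atom has support in some `G_n`, so a single
truncated integral already gives its transform. -/
theorem fourier_atomLp (hμ : μ (chain p 0 : Set (Vilenkin p)) = 1)
    {L : Lp ℂ 2 μ →ₗᵢ[ℂ] Lp ℂ 2 ν}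
    (hL : ∀ b k, L (atomLp hμ 1 b k) =ᵐ[ν] dualAtom b k) (ξ : Dual p) (b : Vilenkin p) (k : ℤ) :
    L (atomLp hμ ξ b k) =ᵐ[ν] fun χ => dualAtom b k (χ * ξ⁻¹) := by
  obtain ⟨m, hm⟩ := b.2
  have hsub : ball b k ⊆ (chain p (min m k) : Set (Vilenkin p)) := by
    intro x hx j hj
    rw [mem_ball_iff_coord.1 hx j (by lia)]
    exact hm j (by lia)
  have h1 := inner_atomLp_ae_eq hμ hL (min m k) (atomLp hμ ξ b k)
  have h2 : indicatorL2 μ (measurableSet_chain (min m k)) (atomLp hμ ξ b k) =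
      atomLp hμ ξ b k := by
    rw [atomLp, indicatorL2_toLp]
    refine MemLp.toLp_congr _ _ (ae_of_all _ fun x => ?_)
    rw [atom, Set.indicator_indicator, Set.inter_eq_right.2 hsub]
  rw [h2] at h1
  refine h1.symm.trans (ae_of_all _ fun χ => ?_)
  dsimp only
  rw [← setIntegral_ball_conj_pairing hμ, atomLp.eq_1 hμ ξ, inner_atomLp_toLp, atom, ball_zero]
  have h3 : ∀ x, (ball b k).indicator (pairing ξ) x * conj (pairing χ x) =
      (ball b k).indicator (fun x => pairing ξ x * conj (pairing χ x)) x := fun x => by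
    by_cases h : x ∈ ball b k <;> simp [h]
  simp only [h3]
  rw [setIntegral_indicator (measurableSet_ball b k), Set.inter_eq_right.2 hsub]
  congr 1
  ext x
  rw [conj_pairing, conj_pairing, ← pairing_mul, mul_inv, inv_inv, mul_comm]

theorem fourier_atomLp_support (hμ : μ (chain p 0 : Set (Vilenkin p)) = 1)
    {L : Lp ℂ 2 μ →ₗᵢ[ℂ] Lp ℂ 2 ν}
    (hL : ∀ b k, L (atomLp hμ 1 b k) =ᵐ[ν] dualAtom b k) (ξ : Dual p) (b : Vilenkin p) (k : ℤ) :
    ∀ᵐ χ ∂ν, χ ∉ ξ • (annih p k : Set (Dual p)) → L (atomLp hμ ξ b k) χ = 0 := by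
  filter_upwards [fourier_atomLp hμ hL ξ b k] with χ hχ hmem
  rw [hχ, dualAtom, Set.indicator_of_notMem]
  rwa [Set.mem_smul_set_iff_inv_smul_mem, smul_eq_mul, mul_comm] at hmem

/-- If `F` is orthogonal to `ξ` on all cosets of `G_k`, then the Fourier transform of `F` vanishes
on `ξ G_k^⊥`. -/
theorem fourier_eq_zero_of_inner_atomLp [ν.IsHaarMeasure]
    (hμ : μ (chain p 0 : Set (Vilenkin p)) = 1)
    {L : Lp ℂ 2 μ →ₗᵢ[ℂ] Lp ℂ 2 ν}
    (hL : ∀ b k, L (atomLp hμ 1 b k) =ᵐ[ν] dualAtom b k) {ξ : Dual p} {k : ℤ} {F : Lp ℂ 2 μ}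
    (hF : ∀ b, inner ℂ (atomLp hμ ξ b k) F = 0) :
    ∀ᵐ χ ∂ν, χ ∈ ξ • (annih p k : Set (Dual p)) → L F χ = 0 := by
  have hint : ∀ (χ : Dual p) b n, IntegrableOn (fun x => F x * conj (pairing χ x)) (ball b n) μ :=
    fun χ b n => by
      have : IsFiniteMeasure (μ.restrict (ball b n)) :=
        ⟨by rw [Measure.restrict_apply_univ]; exact measure_ball_lt_top hμ _ _⟩
      refine (((Lp.memLp F).restrict (ball b n)).integrable (by norm_num)).mul_bdd (c := 1)
        (Complex.continuous_conj.comp (continuous_pairing χ)).aestronglyMeasurable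
        (ae_of_all _ fun x => ?_)
      rw [RCLike.norm_conj, norm_pairing]
  -- On a coset of `G_k` every `χ ∈ ξ G_k^⊥` is a constant multiple of `ξ`, so orthogonality passes
  -- to `χ`; larger balls are finite unions of such cosets. All Fourier integrals over `G_{k-n}`
  -- thus vanish on `ξ G_k^⊥`, and `n → ∞` gives the claim.
  have hzero : ∀ χ ∈ ξ • (annih p k : Set (Dual p)), ∀ (n : ℕ) (b : Vilenkin p),
      inner ℂ (atomLp hμ χ b (k - n)) F = 0 := by
    intro χ hχ n
    induction n with
    | zero =>
      intro b
      obtain ⟨η, hη, rfl⟩ := hχ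
      simp only [Nat.cast_zero, sub_zero]
      rw [inner_atomLp, setIntegral_congr_fun (measurableSet_ball b k)
        (g := fun x => conj (pairing η b) * (F x * conj (pairing ξ x))) fun x hx => by
          have h1 := mem_annih.1 hη _ hx
          rw [pairing_sub] at h1
          have h2 : pairing η x = pairing η b := by
            rw [← mul_one (pairing η x), ← conj_pairing_mul_pairing η b, ← mul_assoc, h1, one_mul]
          dsimp only
          rw [smul_eq_mul, pairing_mul, h2, map_mul]
          ring]
      rw [integral_const_mul, ← inner_atomLp hμ, hF b, mul_zero]
    | succ n ih =>
      intro b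
      have hk : k - ((n + 1 : ℕ) : ℤ) + 1 = k - n := by push_cast; ring
      rw [inner_atomLp, ball_eq_iUnion_ball_succ, integral_iUnion_fintype
        (fun c => measurableSet_ball _ _) (pairwise_disjoint_ball_succ b _)
        (fun c => hint χ _ _)]
      refine Finset.sum_eq_zero fun c _ => ?_
      rw [← inner_atomLp hμ, hk]
      exact ih _
  have hS := measurableSet_smul_annih ξ k
  rw [← indicatorL2_eq_zero_iff hS]
  have hlim := tendsto_indicatorL2 (m := μ)
    (fun n : ℕ => measurableSet_chain (p := p) (k - n)) (fun x => by
      obtain ⟨n, hn⟩ := Set.mem_iUnion.1 (iUnion_chain.ge (Set.mem_univ x))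
      filter_upwards [eventually_ge_atTop (n + k.natAbs)] with j hj
      exact chain_le_chain (by lia) hn) F
  refine tendsto_nhds_unique ((((indicatorL2 ν hS).continuous.comp L.continuous).tendsto F).comp
    hlim) (tendsto_const_nhds.congr fun n => ?_)
  simp only [Function.comp_apply]
  symm
  rw [indicatorL2_eq_zero_iff]
  filter_upwards [inner_atomLp_ae_eq hμ hL (k - n) F] with χ h1 h2
  rw [← h1]
  exact hzero χ h2 n 0

/-- The inverse Fourier transform of the indicator of a coset of `G_k^⊥`. -/
theorem ae_eq_atom_of_isFourierTransform (hμ : μ (chain p 0 : Set (Vilenkin p)) = 1)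
    {L : Lp ℂ 2 μ →ₗᵢ[ℂ] Lp ℂ 2 ν}
    (hL : ∀ b k, L (atomLp hμ 1 b k) =ᵐ[ν] dualAtom b k) {ψ : Vilenkin p → ℂ} {F : Dual p → ℂ}
    {ξ : Dual p} {k : ℤ}
    (hF : F =ᵐ[ν] (ξ • (annih p k : Set (Dual p))).indicator fun _ => (1 : ℂ))
    (hψ : IsFourierTransform μ ν ψ F) : ψ =ᵐ[μ] fun x => (p : ℂ) ^ k * atom ξ 0 k x := by
  have hp : (p : ℂ) ≠ 0 := by simpa using NeZero.ne p
  have h1 := hψ.ae_eq hμ hL hψ.1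
  have h2 : L (hψ.1.toLp ψ) = L ((p : ℂ) ^ k • atomLp hμ ξ 0 k) := by
    refine Lp.ext ?_
    rw [map_smul]
    filter_upwards [h1, hF, fourier_atomLp hμ hL ξ 0 k,
      Lp.coeFn_smul ((p : ℂ) ^ k) (L (atomLp hμ ξ 0 k))] with χ h3 h4 h5 h6
    rw [← h3, h4, h6, Pi.smul_apply, h5, dualAtom, smul_eq_mul]
    by_cases h : χ ∈ ξ • (annih p k : Set (Dual p))
    · rw [Set.indicator_of_mem h]
      rw [Set.mem_smul_set_iff_inv_smul_mem, smul_eq_mul, mul_comm] at h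
      rw [Set.indicator_of_mem h, pairing_zero, map_one, mul_one, ← zpow_add₀ hp,
        add_neg_cancel, zpow_zero]
    · rw [Set.indicator_of_notMem h]
      rw [Set.mem_smul_set_iff_inv_smul_mem, smul_eq_mul, mul_comm] at h
      rw [Set.indicator_of_notMem h, mul_zero]
  have h3 := L.injective h2
  have h4 := hψ.1.coeFn_toLp
  rw [h3] at h4
  filter_upwards [h4, Lp.coeFn_smul ((p : ℂ) ^ k) (atomLp hμ ξ 0 k),
    (memLp_atom hμ ξ 0 k).coeFn_toLp] with x h5 h6 h7
  rw [← h5, h6, Pi.smul_apply, atomLp, h7, smul_eq_mul]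

end Modulated
end VilenkinFrame
end

noncomputable section
namespace VilenkinFrame

/-! ### The frame vectors: norms, coincidences and Fourier supports -/

section Frame

variable {p : ℕ} [Fact p.Prime] {μ : Measure (Vilenkin p)} [μ.IsAddHaarMeasure]
  {ν : Measure (Dual p)}

omit [Fact p.Prime] in
theorem atom_zero_dil_sub (ξ : Dual p) (k n : ℤ) (h x : Vilenkin p) :
    atom ξ 0 k (dil n x - h) =
      conj (pairing ξ h) * atom (dualDil n ξ) (dil (-n) h) (k + n) x := by
  have hiff : dil n x - h ∈ ball 0 k ↔ x ∈ ball (dil (-n) h) (k + n) := by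
    rw [← dil_preimage_ball]
    simp only [Set.mem_preimage, mem_ball, sub_zero]
  by_cases hx : x ∈ ball (dil (-n) h) (k + n)
  · rw [atom, atom, Set.indicator_of_mem hx, Set.indicator_of_mem (hiff.2 hx), pairing_sub,
      pairing_dualDil, mul_comm]
  · rw [atom, atom, Set.indicator_of_notMem hx, Set.indicator_of_notMem (fun h' => hx (hiff.1 h')),
      mul_zero]

/-- The element `ψ_{n,h}` of `L₂(G)`, for the function `ψ` whose Fourier transform is the indicator
of `ξ G_k^⊥`. -/
def frameVec (hμ : μ (chain p 0 : Set (Vilenkin p)) = 1) (ξ : Dual p) (k n : ℤ) (h : Vilenkin p) :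
    Lp ℂ 2 μ :=
  ((((p : ℝ) ^ ((n : ℝ) / 2) : ℝ) : ℂ) * (p : ℂ) ^ k * conj (pairing ξ h)) •
    atomLp hμ (dualDil n ξ) (dil (-n) h) (k + n)

theorem frameElt_ae_eq (hμ : μ (chain p 0 : Set (Vilenkin p)) = 1) {ξ : Dual p} {k : ℤ}
    {ψ : Vilenkin p → ℂ} (hψ : ψ =ᵐ[μ] fun x => (p : ℂ) ^ k * atom ξ 0 k x) (n : ℤ)
    (h : Vilenkin p) : frameElt ψ n h =ᵐ[μ] frameVec hμ ξ k n h := by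
  filter_upwards [(quasiMeasurePreserving_dil_sub hμ n h).ae hψ,
    Lp.coeFn_smul ((((p : ℝ) ^ ((n : ℝ) / 2) : ℝ) : ℂ) * (p : ℂ) ^ k * conj (pairing ξ h))
      (atomLp hμ (dualDil n ξ) (dil (-n) h) (k + n)),
    (memLp_atom hμ (dualDil n ξ) (dil (-n) h) (k + n)).coeFn_toLp] with x h1 h2 h3
  rw [frameElt, h1, atom_zero_dil_sub, frameVec, h2, Pi.smul_apply, atomLp, h3, smul_eq_mul]
  ring

/-- The factors are `p^n`, `p^{2k}` and the measure `p^{-(k+n)}` of the ball. -/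
theorem norm_frameVec_sq (hμ : μ (chain p 0 : Set (Vilenkin p)) = 1) (ξ : Dual p) (k n : ℤ)
    (h : Vilenkin p) : ‖frameVec hμ ξ k n h‖ ^ 2 = (p : ℝ) ^ k := by
  have hp : (0 : ℝ) < p := by exact_mod_cast (Fact.out : p.Prime).pos
  rw [frameVec, norm_smul, mul_pow, norm_atomLp_sq, norm_mul, norm_mul, RCLike.norm_conj,
    norm_pairing, mul_one, mul_pow, Complex.norm_real, norm_zpow, Complex.norm_natCast,
    Real.norm_of_nonneg (Real.rpow_nonneg hp.le _), ← Real.rpow_natCast, ← Real.rpow_mul hp.le,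
    Nat.cast_ofNat, div_mul_cancel₀ _ two_ne_zero, Real.rpow_intCast, ← zpow_natCast,
    ← zpow_mul, ← zpow_add₀ hp.ne', ← zpow_add₀ hp.ne']
  congr 1
  push_cast
  ring

theorem frameVec_ne_zero (hμ : μ (chain p 0 : Set (Vilenkin p)) = 1) (ξ : Dual p) (k n : ℤ)
    (h : Vilenkin p) : frameVec hμ ξ k n h ≠ 0 := by
  intro h0
  have h1 := norm_frameVec_sq hμ ξ k n h
  rw [h0, norm_zero, zero_pow two_ne_zero] at h1
  have hp : (p : ℝ) ≠ 0 := by simpa using NeZero.ne p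
  exact zpow_ne_zero k hp h1.symm

theorem norm_frameVec_le_one (hμ : μ (chain p 0 : Set (Vilenkin p)) = 1) (ξ : Dual p) {k : ℤ}
    (hk : k ≤ 0) (n : ℤ) (h : Vilenkin p) : ‖frameVec hμ ξ k n h‖ ≤ 1 := by
  rw [← sq_le_one_iff₀ (norm_nonneg _), norm_frameVec_sq]
  exact zpow_le_one_of_nonpos₀ (by exact_mod_cast (Fact.out : p.Prime).one_lt.le) hk

theorem frameVec_eq_smul (hμ : μ (chain p 0 : Set (Vilenkin p)) = 1) (ξ : Dual p) {k : ℤ} (n : ℤ)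
    {h h' : Vilenkin p} (hh : h' - h ∈ chain p k) :
    frameVec hμ ξ k n h' = conj (pairing ξ (h' - h)) • frameVec hμ ξ k n h := by
  have hb : dil (-n) h' ∈ ball (dil (-n) h) (k + n) := by
    rw [mem_ball, ← map_sub, dil_mem_chain, add_neg_cancel_right]
    exact hh
  rw [frameVec, frameVec, atomLp_congr hμ _ hb, smul_smul]
  congr 1
  have : conj (pairing ξ h') = conj (pairing ξ (h' - h)) * conj (pairing ξ h) := by
    rw [← map_mul, ← pairing_add, sub_add_cancel]
  rw [this]
  ring

/-- The vectors differ by a phase, which cancels in the rank-one term: shifts in one coset of `G_k`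
repeat the same summand. -/
theorem inner_frameVec_smul (hμ : μ (chain p 0 : Set (Vilenkin p)) = 1) (ξ : Dual p) {k : ℤ}
    (n : ℤ) {h h' : Vilenkin p} (hh : h' - h ∈ chain p k) (F : Lp ℂ 2 μ) :
    inner ℂ (frameVec hμ ξ k n h') F • frameVec hμ ξ k n h' =
      inner ℂ (frameVec hμ ξ k n h) F • frameVec hμ ξ k n h := by
  rw [frameVec_eq_smul hμ ξ n hh, inner_smul_left, smul_smul, Complex.conj_conj,
    mul_right_comm, mul_comm (pairing ξ _), conj_pairing_mul_pairing, one_mul]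

theorem inner_frameVec_of_notMem (hμ : μ (chain p 0 : Set (Vilenkin p)) = 1) (ξ : Dual p) {k : ℤ}
    (n : ℤ) {h h' : Vilenkin p} (hh : h' - h ∉ chain p k) :
    inner ℂ (frameVec hμ ξ k n h) (frameVec hμ ξ k n h') = 0 := by
  rw [frameVec, frameVec, inner_smul_left, inner_smul_right, inner_atomLp_of_notMem, mul_zero,
    mul_zero]
  rwa [mem_ball, ← map_sub, dil_mem_chain, add_neg_cancel_right]

theorem fourier_frameVec_support (hμ : μ (chain p 0 : Set (Vilenkin p)) = 1)
    {L : Lp ℂ 2 μ →ₗᵢ[ℂ] Lp ℂ 2 ν}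
    (hL : ∀ b k, L (atomLp hμ 1 b k) =ᵐ[ν] dualAtom b k) (ξ : Dual p) (k n : ℤ)
    (h : Vilenkin p) :
    ∀ᵐ χ ∂ν, χ ∉ dualDil n '' (ξ • (annih p k : Set (Dual p))) →
      L (frameVec hμ ξ k n h) χ = 0 := by
  rw [dualDil_image_smul_annih, frameVec, map_smul]
  filter_upwards [fourier_atomLp_support hμ hL (dualDil n ξ) (dil (-n) h) (k + n),
    Lp.coeFn_smul ((((p : ℝ) ^ ((n : ℝ) / 2) : ℝ) : ℂ) * (p : ℂ) ^ k * conj (pairing ξ h))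
      (L (atomLp hμ (dualDil n ξ) (dil (-n) h) (k + n)))] with χ h1 h2 h3
  rw [h2, Pi.smul_apply, h1 h3, smul_zero]

/-- The part of a sequence with negative indices. -/
def principalPart (x : Vilenkin p) : Vilenkin p :=
  ⟨fun k => if k < 0 then coord x k else 0, by
    obtain ⟨m, hm⟩ := x.2
    refine ⟨m, fun k hk => ?_⟩
    dsimp only
    split_ifs
    · exact hm k hk
    · rfl⟩

theorem coord_principalPart (x : Vilenkin p) (k : ℤ) :
    coord (principalPart x) k = if k < 0 then coord x k else 0 := rfl

theorem principalPart_mem_H0 (x : Vilenkin p) : principalPart x ∈ H0 p := by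
  intro k hk
  rw [coord_principalPart, if_neg (by lia)]

theorem sub_principalPart_mem_chain (x : Vilenkin p) : x - principalPart x ∈ chain p 0 := by
  intro k hk
  rw [coord_sub, coord_principalPart, if_pos hk, sub_self]

/-- As `k ≤ 0`, every coset of `G_k` meets `H₀`, so the shifts by `H₀` alone reach every ball of the
level `k + n`. -/
theorem fourier_eq_zero_of_inner_frameVec [ν.IsHaarMeasure]
    (hμ : μ (chain p 0 : Set (Vilenkin p)) = 1) {L : Lp ℂ 2 μ →ₗᵢ[ℂ] Lp ℂ 2 ν}
    (hL : ∀ b k, L (atomLp hμ 1 b k) =ᵐ[ν] dualAtom b k) {ξ : Dual p} {k n : ℤ} (hk : k ≤ 0)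
    {F : Lp ℂ 2 μ} (hF : ∀ h ∈ H0 p, inner ℂ (frameVec hμ ξ k n h) F = 0) :
    ∀ᵐ χ ∂ν, χ ∈ dualDil n '' (ξ • (annih p k : Set (Dual p))) → L F χ = 0 := by
  have hp : (0 : ℝ) < p := by exact_mod_cast (Fact.out : p.Prime).pos
  rw [dualDil_image_smul_annih]
  refine fourier_eq_zero_of_inner_atomLp hμ hL fun b => ?_
  -- Dropping the coordinates of index `≥ 0` changes `𝒜^n b` only by an element of `G_0 ⊆ G_k`.
  set h := principalPart (dil n b)
  have hb : b ∈ ball (dil (-n) h) (k + n) := by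
    rw [← dil_preimage_ball, Set.mem_preimage, mem_ball]
    exact chain_le_chain hk (sub_principalPart_mem_chain _)
  have h1 := hF h (principalPart_mem_H0 _)
  rw [frameVec, inner_smul_left, ← atomLp_congr hμ _ hb] at h1
  refine (mul_eq_zero.1 h1).resolve_left ?_
  rw [← ne_eq, map_ne_zero]
  refine mul_ne_zero (mul_ne_zero ?_ (zpow_ne_zero _ ?_)) ?_
  · exact_mod_cast (Real.rpow_pos_of_pos hp _).ne'
  · exact_mod_cast hp.ne'
  · rw [map_ne_zero]
    exact pairing_ne_zero _ _

/-- The element of `H₀ ∩ G_{-s}` with prescribed coordinates. -/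
def ofCoords (s : ℕ) (e : Finset.Ico (-(s : ℤ)) 0 → ZMod p) : Vilenkin p :=
  ⟨fun k => if hk : k ∈ Finset.Ico (-(s : ℤ)) 0 then e ⟨k, hk⟩ else 0, -(s : ℤ), fun k hk => by
    dsimp only
    rw [dif_neg]
    rw [Finset.mem_Ico]
    lia⟩

theorem coord_ofCoords (s : ℕ) (e : Finset.Ico (-(s : ℤ)) 0 → ZMod p) (k : ℤ) :
    coord (ofCoords s e) k = if hk : k ∈ Finset.Ico (-(s : ℤ)) 0 then e ⟨k, hk⟩ else 0 := rfl

theorem ofCoords_injective (s : ℕ) : Function.Injective (ofCoords (p := p) s) := by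
  intro e e' h
  ext k
  have := congrArg (fun x => coord x k) h
  simpa [coord_ofCoords, k.2] using this

/-- The elements of `H₀` in the same coset of `G_{-s}` form a set of cardinality `p ^ s`. -/
theorem exists_finset_H0_sub_mem_chain (s : ℕ) (h : H0 p) :
    ∃ A : Finset (H0 p), A.card = p ^ s ∧
      ∀ h', h' ∈ A ↔ (h' : Vilenkin p) - h ∈ chain p (-(s : ℤ)) := by
  classical
  let g : (Finset.Ico (-(s : ℤ)) 0 → ZMod p) → H0 p := fun e =>
    ⟨(h : Vilenkin p) + ofCoords s e, fun k hk => by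
      rw [coord_add, h.2 k hk, coord_ofCoords, dif_neg (by rw [Finset.mem_Ico]; lia), add_zero]⟩
  have hg : Function.Injective g := fun e e' hee => by
    have := congrArg Subtype.val hee
    exact ofCoords_injective s (add_left_cancel this)
  refine ⟨Finset.univ.image g, ?_, fun h' => ?_⟩
  · rw [Finset.card_image_of_injective _ hg]
    simp [ZMod.card]
  · simp only [Finset.mem_image, Finset.mem_univ, true_and]
    constructor
    · rintro ⟨e, rfl⟩ k hk
      simp only [g, add_sub_cancel_left]
      rw [coord_ofCoords, dif_neg (by rw [Finset.mem_Ico]; lia)]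
    · intro hmem
      refine ⟨fun k => coord ((h' : Vilenkin p) - h) k, Subtype.ext ?_⟩
      ext k
      simp only [g, coord_add, coord_ofCoords]
      split_ifs with hk
      · rw [coord_sub]; ring
      · rw [Finset.mem_Ico] at hk
        rcases lt_or_ge k (-(s : ℤ)) with h1 | h1
        · have := hmem k h1
          rw [coord_sub, sub_eq_zero] at this
          rw [this, add_zero]
        · rw [h.2 k (by lia), h'.2 k (by lia), add_zero]

end Frame

end VilenkinFrame

/-- With `B` the right side, `a i = a_i^{1/2} a_i^{1/2} ≤ a_i^{1/2} B`; summing gives `∑ a i ≤ B²`.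
-/
theorem ENNReal.tsum_rpow_half_le {ι : Type*} (a : ι → ℝ≥0∞) :
    (∑' i, a i) ^ ((1 : ℝ) / 2) ≤ ∑' i, a i ^ ((1 : ℝ) / 2) := by
  set B := ∑' i, a i ^ ((1 : ℝ) / 2)
  have h1 : ∑' i, a i ≤ B ^ (2 : ℝ) := by
    calc ∑' i, a i ≤ ∑' i, a i ^ ((1 : ℝ) / 2) * B := by
          refine ENNReal.tsum_le_tsum fun i => ?_
          calc a i = a i ^ ((1 : ℝ) / 2) * a i ^ ((1 : ℝ) / 2) := by
                rw [← ENNReal.rpow_add_of_nonneg _ _ (by norm_num) (by norm_num)]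
                norm_num
            _ ≤ _ := by
                gcongr
                exact ENNReal.le_tsum i
      _ = B ^ (2 : ℝ) := by
          rw [ENNReal.tsum_mul_right, ENNReal.rpow_two, sq]
  calc _ ≤ (B ^ (2 : ℝ)) ^ ((1 : ℝ) / 2) := ENNReal.rpow_le_rpow h1 (by norm_num)
    _ = B := by rw [← ENNReal.rpow_mul]; norm_num

end

noncomputable section
namespace VilenkinFrame

/-! ### The dilated cosets tile the nontrivial characters -/

section Tiling

variable {p : ℕ} [NeZero p] {q M : ℕ} {E : Fin q → Set (Dual p)} {t : Fin q → ℕ}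

-- `E_j 𝒜^n` is the dilate by `n - t(j)` of a piece of the shell of index `M`.
omit [NeZero p] in
theorem dualDil_image_subset_shell
    (htunion : (⋃ j, dualDil (t j) '' E j) = shell p M) (n : ℤ) (j : Fin q) :
    dualDil n '' E j ⊆ shell p (n - t j + M) := by
  rintro _ ⟨χ, hχ, rfl⟩
  have h1 : dualDil (t j) χ ∈ shell p M := by
    rw [← htunion]
    exact Set.mem_iUnion.2 ⟨j, χ, hχ, rfl⟩
  have h2 := dualDil_mem_shell_iff (n := n - t j).2 h1
  rwa [dualDil_dualDil, sub_add_cancel, add_comm] at h2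

-- Either the two tiles lie in different shells, or `n - t(i) = m - t(j)` and they are the same
-- dilate of two disjoint pieces of one shell.
omit [NeZero p] in
theorem disjoint_dualDil_image
    (htdisj : Pairwise fun i j => Disjoint (dualDil (t i) '' E i) (dualDil (t j) '' E j))
    (htunion : (⋃ j, dualDil (t j) '' E j) = shell p M) {n m : ℤ} {i j : Fin q}
    (h : (n, i) ≠ (m, j)) : Disjoint (dualDil n '' E i) (dualDil m '' E j) := by
  by_cases hk : n - t i + M = m - t j + M
  · have hij : i ≠ j := by
      rintro rfl
      exact h (by rw [show n = m by lia])
    have h1 : dualDil n '' E i = dualDil (n - t i) '' (dualDil (t i) '' E i) := by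
      rw [dualDil_image_image, sub_add_cancel]
    have h2 : dualDil m '' E j = dualDil (n - t i) '' (dualDil (t j) '' E j) := by
      rw [dualDil_image_image, show n - t i = m - t j by lia, sub_add_cancel]
    rw [h1, h2, Set.disjoint_image_iff]
    · exact htdisj hij
    · intro χ η hχη
      have := congrArg (dualDil (-(n - t i))) hχη
      simpa only [dualDil_dualDil, neg_add_cancel, dualDil_zero] using this
  · exact (disjoint_shell hk).mono (dualDil_image_subset_shell htunion n i)
      (dualDil_image_subset_shell htunion m j)

theorem exists_mem_dualDil_image (htunion : (⋃ j, dualDil (t j) '' E j) = shell p M)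
    {χ : Dual p} (hχ : χ ≠ 1) : ∃ (n : ℤ) (j : Fin q), χ ∈ dualDil n '' E j := by
  obtain ⟨k, hk⟩ := exists_mem_shell hχ
  have h1 := dualDil_mem_shell_iff (n := M - k).2 hk
  rw [add_sub_cancel, ← htunion] at h1
  obtain ⟨j, hj⟩ := Set.mem_iUnion.1 h1
  -- Dilating by `M - k` moves `χ` into the tiled shell, where it lies in `E_j 𝒜^{t(j)}`; undoing
  -- this adds `k - M` to `t(j)`.
  refine ⟨k - M + t j, j, ?_⟩
  rw [← dualDil_image_image]
  refine ⟨_, hj, ?_⟩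
  rw [dualDil_dualDil, sub_add_sub_cancel, sub_self, dualDil_zero]

end Tiling

/-! ### Convergence of the expansion and the spectrum of the remainder -/

section Expansion

variable {p : ℕ} [Fact p.Prime] {μ : Measure (Vilenkin p)} [μ.IsAddHaarMeasure]
  {ν : Measure (Dual p)} {q : ℕ} {ξ : Fin q → Dual p} {s : Fin q → ℕ} {L : Lp ℂ 2 μ →ₗᵢ[ℂ] Lp ℂ 2 ν}

theorem inner_frameVec_of_disjoint
    (hμ : μ (chain p 0 : Set (Vilenkin p)) = 1)
    (hL : ∀ b k, L (atomLp hμ 1 b k) =ᵐ[ν] dualAtom b k) {ξ η : Dual p} {k m n n' : ℤ}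
    (hd : Disjoint (dualDil n '' (ξ • (annih p k : Set (Dual p))))
      (dualDil n' '' (η • (annih p m : Set (Dual p))))) (h h' : Vilenkin p) :
    inner ℂ (frameVec hμ ξ k n h) (frameVec hμ η m n' h') = 0 := by
  rw [← L.inner_map_map]
  exact inner_eq_zero_of_disjoint_support hd (fourier_frameVec_support hμ hL _ _ _ _)
    (fourier_frameVec_support hμ hL _ _ _ _)

/-- Coincidences up to phase prevent orthogonality of the whole family, but they have bounded
multiplicity: finitely many colours separate it into orthogonal families. -/
theorem summable_frameVec
    (hμ : μ (chain p 0 : Set (Vilenkin p)) = 1)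
    (hL : ∀ b k, L (atomLp hμ 1 b k) =ᵐ[ν] dualAtom b k)
    (hd : ∀ {n m : ℤ} {i j : Fin q}, (n, i) ≠ (m, j) →
      Disjoint (dualDil n '' (ξ i • (annih p (-(s i : ℤ)) : Set (Dual p))))
        (dualDil m '' (ξ j • (annih p (-(s j : ℤ)) : Set (Dual p)))))
    (Nt : ℤ) (F : Lp ℂ 2 μ) :
    Summable fun i : Set.Iic Nt × Fin q × H0 p =>
      inner ℂ (frameVec hμ (ξ i.2.1) (-(s i.2.1 : ℤ)) i.1 i.2.2) F •
        frameVec hμ (ξ i.2.1) (-(s i.2.1 : ℤ)) i.1 i.2.2 := by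
  set S := Finset.univ.sup s
  refine summable_inner_smul_of_coloring (fun i => frameVec_ne_zero _ _ _ _ _)
    (fun i => norm_frameVec_le_one _ _ (by lia) _ _)
    -- The colour records the coordinates of `h` from `-S` to `-1`, with `S` the largest `s j`. Two
    -- elements of `H₀` of the same colour in one coset of `G_{-s j}` are equal.
    (fun i (k : Finset.Ico (-(S : ℤ)) 0) => coord (i.2.2 : Vilenkin p) k) ?_ F
  rintro ⟨n, i, h⟩ ⟨m, j, h'⟩ hne hκ
  by_cases hnm : ((n : ℤ), i) = ((m : ℤ), j)
  · obtain ⟨h1, rfl⟩ := Prod.ext_iff.1 hnm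
    obtain rfl := Subtype.ext h1
    refine inner_frameVec_of_notMem hμ _ _ fun hmem => hne ?_
    rw [Prod.mk.injEq, Prod.mk.injEq]
    refine ⟨rfl, rfl, Subtype.ext (Vilenkin.ext fun k => ?_)⟩
    rcases lt_or_ge k 0 with hk | hk
    · by_cases hkS : -(S : ℤ) ≤ k
      · exact congrFun hκ ⟨k, Finset.mem_Ico.2 ⟨hkS, hk⟩⟩
      · have hs : s i ≤ S := Finset.le_sup (Finset.mem_univ i)
        have := hmem k (by lia)
        rw [coord_sub, sub_eq_zero] at this
        exact this.symm
    · rw [h.2 k hk, h'.2 k hk]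
  · exact inner_frameVec_of_disjoint hμ hL (hd hnm) _ _

/-- The terms not orthogonal to the given vector come from the `p^{s j}` shifts in its coset. They
coincide, and their number compensates the squared norm `p^{-s j}`. -/
theorem inner_frameVec_sub_hasSum
    (hμ : μ (chain p 0 : Set (Vilenkin p)) = 1)
    (hL : ∀ b k, L (atomLp hμ 1 b k) =ᵐ[ν] dualAtom b k)
    (hd : ∀ {n m : ℤ} {i j : Fin q}, (n, i) ≠ (m, j) →
      Disjoint (dualDil n '' (ξ i • (annih p (-(s i : ℤ)) : Set (Dual p))))
        (dualDil m '' (ξ j • (annih p (-(s j : ℤ)) : Set (Dual p)))))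
    {Nt : ℤ} {F G : Lp ℂ 2 μ}
    (hG : HasSum (fun i : Set.Iic Nt × Fin q × H0 p =>
      inner ℂ (frameVec hμ (ξ i.2.1) (-(s i.2.1 : ℤ)) i.1 i.2.2) F •
        frameVec hμ (ξ i.2.1) (-(s i.2.1 : ℤ)) i.1 i.2.2) G) {n : ℤ} (hn : n ≤ Nt) (j : Fin q)
    (h : H0 p) :
    inner ℂ (frameVec hμ (ξ j) (-(s j : ℤ)) n h) (F - G) = 0 := by
  classical
  have hp : (p : ℝ) ≠ 0 := by simpa using NeZero.ne p
  obtain ⟨A, hcard, hA⟩ := exists_finset_H0_sub_mem_chain (s j) h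
  let emb : H0 p ↪ Set.Iic Nt × Fin q × H0 p :=
    ⟨fun h => (⟨n, hn⟩, j, h), fun a b hab => by simpa using hab⟩
  refine inner_sub_hasSum_eq_zero hG (⟨n, hn⟩, j, h) (A.map emb) ?_ ?_ ?_
  · intro i hi
    obtain ⟨h', hh', rfl⟩ := Finset.mem_map.1 hi
    exact inner_frameVec_smul hμ _ _ ((hA h').1 hh') F
  · rintro ⟨m, i, h'⟩ hi
    by_cases hnm : (n, j) = ((m : ℤ), i)
    · obtain ⟨h1, rfl⟩ := Prod.ext_iff.1 hnm
      obtain rfl : (⟨n, hn⟩ : Set.Iic Nt) = m := Subtype.ext h1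
      refine inner_frameVec_of_notMem hμ _ _ fun hmem => hi ?_
      exact Finset.mem_map.2 ⟨h', (hA h').2 hmem, rfl⟩
    · exact inner_frameVec_of_disjoint hμ hL (hd hnm) _ _
  · rw [Finset.card_map, hcard, norm_frameVec_sq, zpow_neg, zpow_natCast, Nat.cast_pow]
    exact mul_inv_cancel₀ (pow_ne_zero _ hp)

/-- Transforming and restricting to a tile with `n > Nt` is continuous and linear, and it kills
every term, since the terms live on tiles with smaller `n`. -/
theorem fourier_hasSum_eq_zero
    (hμ : μ (chain p 0 : Set (Vilenkin p)) = 1)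
    (hL : ∀ b k, L (atomLp hμ 1 b k) =ᵐ[ν] dualAtom b k)
    (hd : ∀ {n m : ℤ} {i j : Fin q}, (n, i) ≠ (m, j) →
      Disjoint (dualDil n '' (ξ i • (annih p (-(s i : ℤ)) : Set (Dual p))))
        (dualDil m '' (ξ j • (annih p (-(s j : ℤ)) : Set (Dual p)))))
    [ν.IsHaarMeasure] {Nt : ℤ} {c : Set.Iic Nt × Fin q × H0 p → ℂ} {G : Lp ℂ 2 μ}
    (hG : HasSum (fun i => c i • frameVec hμ (ξ i.2.1) (-(s i.2.1 : ℤ)) i.1 i.2.2) G) {n : ℤ}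
    (hn : Nt < n) (j : Fin q) :
    ∀ᵐ χ ∂ν, χ ∈ dualDil n '' (ξ j • (annih p (-(s j : ℤ)) : Set (Dual p))) → L G χ = 0 := by
  have hS : MeasurableSet (dualDil n '' (ξ j • (annih p (-(s j : ℤ)) : Set (Dual p)))) := by
    rw [dualDil_image_smul_annih]
    exact measurableSet_smul_annih _ _
  rw [← indicatorL2_eq_zero_iff hS]
  have h1 : HasSum (fun i : Set.Iic Nt × Fin q × H0 p => indicatorL2 ν hS
      (L (c i • frameVec hμ (ξ i.2.1) (-(s i.2.1 : ℤ)) i.1 i.2.2))) (indicatorL2 ν hS (L G)) :=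
    ((indicatorL2 ν hS).comp L.toContinuousLinearMap).hasSum hG
  refine h1.unique ?_
  convert hasSum_zero with i
  rw [map_smul, map_smul, (indicatorL2_eq_zero_iff hS _).2, smul_zero]
  filter_upwards [fourier_frameVec_support hμ hL (ξ i.2.1) (-(s i.2.1 : ℤ)) i.1 i.2.2] with χ h2 h3
  refine h2 fun h4 => ?_
  refine Set.disjoint_left.1 (hd ?_) h3 h4
  intro heq
  have h5 := congrArg Prod.fst heq
  have h6 : (i.1 : ℤ) ≤ Nt := i.1.2
  simp only at h5
  lia

end Expansion

end VilenkinFrame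

end

/-! ### The error estimate -/

open VilenkinFrame in
theorem theorem4p1 (p : ℕ) [Fact p.Prime]
    -- the Haar measures of `G` and of `X`, normalized by `μ(G_0) = 1` and `ν(G_0^⊥) = 1`
    (μ : Measure (VilenkinFrame.Vilenkin p)) [μ.IsAddHaarMeasure]
    (hμ : μ (VilenkinFrame.chain p 0 : Set (VilenkinFrame.Vilenkin p)) = 1)
    (ν : Measure (VilenkinFrame.Dual p)) [ν.IsHaarMeasure]
    (hν : ν (VilenkinFrame.annih p 0 : Set (VilenkinFrame.Dual p)) = 1)
    -- a Rademacher system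
    (r : ℤ → VilenkinFrame.Dual p) (hr : ∀ n, r n ∈ VilenkinFrame.shell p n)
    -- a step refinable function, its Fourier transform and its mask
    (M N : ℕ) (φ : VilenkinFrame.Vilenkin p → ℂ) (φhat m₀ : VilenkinFrame.Dual p → ℂ)
    (hφ : φ ∈ VilenkinFrame.stepSpace μ M N)
    (hφhat : VilenkinFrame.IsFourierTransform μ ν φ φhat)
    (hφref : VilenkinFrame.IsRefinable μ ν φ m₀)
    -- the masks `m_j`, with `φhat(χ𝒜⁻¹) m_j(χ) = 1_{E_j}(χ)`, and the disjoint cosets `E_j`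
    (q : ℕ) (s : Fin q → ℕ) (a : Fin q → ℤ → Fin p) (E : Fin q → Set (VilenkinFrame.Dual p))
    (hE : ∀ j, E j = VilenkinFrame.coset r M (s j) (a j))
    (m : Fin q → VilenkinFrame.Dual p → ℂ)
    (hmask : ∀ j, ∃ β : VilenkinFrame.H0 p → ℂ, VilenkinFrame.IsMaskOf ν β (m j))
    (hm : ∀ j, (fun χ => φhat (VilenkinFrame.dualDil (-1) χ) * m j χ) =ᵐ[ν]
      (E j).indicator (fun _ => (1 : ℂ)))
    (hEdisj : ∀ n : ℤ, Pairwise fun i j =>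
      Disjoint (VilenkinFrame.dualDil n '' E i) (VilenkinFrame.dualDil n '' E j))
    -- the integers `t(j) ≥ 0`, with `G_{M+1}^⊥ ∖ G_M^⊥` the disjoint union of the `E_j 𝒜^{t(j)}`
    (t : Fin q → ℕ)
    (htdisj : Pairwise fun i j =>
      Disjoint (VilenkinFrame.dualDil (t i) '' E i) (VilenkinFrame.dualDil (t j) '' E j))
    (htunion : (⋃ j, VilenkinFrame.dualDil (t j) '' E j) = VilenkinFrame.shell p M)
    -- the functions `ψ_j`, whose Fourier transforms are `φhat(χ𝒜⁻¹) m_j(χ)`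
    (ψ : Fin q → VilenkinFrame.Vilenkin p → ℂ)
    (hψ : ∀ j, VilenkinFrame.IsFourierTransform μ ν (ψ j)
      (fun χ => φhat (VilenkinFrame.dualDil (-1) χ) * m j χ))
    (l : ℕ) (hl : IsGreatest (Set.range t) l)
    (Nt : ℕ) (hNt : N < Nt)
    (f : VilenkinFrame.Vilenkin p → ℂ) (hf : MemLp f 2 μ) :
    -- the partial frame expansion converges in `L₂(G)`, to `g` say; the Fourier transform of `f`
    -- exists, and the bound holds for it
    ∃ g : VilenkinFrame.Vilenkin p → ℂ,
      VilenkinFrame.HasL2Sum μ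
        (fun (i : Set.Iic (Nt : ℤ) × Fin q × VilenkinFrame.H0 p) x =>
          VilenkinFrame.ip μ f (VilenkinFrame.frameElt (ψ i.2.1) i.1 i.2.2) *
            VilenkinFrame.frameElt (ψ i.2.1) i.1 i.2.2 x) g ∧
      (∃ fhat : VilenkinFrame.Dual p → ℂ, VilenkinFrame.IsFourierTransform μ ν f fhat) ∧
      ∀ fhat : VilenkinFrame.Dual p → ℂ, VilenkinFrame.IsFourierTransform μ ν f fhat →
        eLpNorm (fun x => f x - g x) 2 μ ≤
          (p : ℝ≥0∞) ^ ((M : ℝ) / 2) * ((N : ℝ≥0∞) + 1) *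
            ∑' n : Set.Ioi (Nt : ℤ),
              (∫⁻ χ in VilenkinFrame.shell p ((n : ℤ) - l + M), ‖fhat χ‖ₑ ^ 2 ∂ν)
                ^ ((1 : ℝ) / 2) := by
  have : NeZero p := ⟨(Fact.out : p.Prime).ne_zero⟩
  obtain ⟨L, hL⟩ := exists_fourier hμ hν hr
  set ξ : Fin q → Dual p := fun j =>
    ∏ k ∈ Finset.Icc (-(s j : ℤ)) (M : ℤ), r k ^ (a j k : ℕ)
  have hE' : ∀ j, E j = ξ j • (annih p (-(s j : ℤ)) : Set (Dual p)) := hE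
  have hd : ∀ {n m : ℤ} {i j : Fin q}, (n, i) ≠ (m, j) →
      Disjoint (dualDil n '' (ξ i • (annih p (-(s i : ℤ)) : Set (Dual p))))
        (dualDil m '' (ξ j • (annih p (-(s j : ℤ)) : Set (Dual p)))) := by
    intro n m i j h
    rw [← hE', ← hE']
    exact disjoint_dualDil_image htdisj htunion h
  have hψ' : ∀ j, ψ j =ᵐ[μ] fun x => (p : ℂ) ^ (-(s j : ℤ)) * atom (ξ j) 0 (-(s j : ℤ)) x :=
    fun j => ae_eq_atom_of_isFourierTransform hμ hL (by rw [← hE']; exact hm j) (hψ j)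
  set w : Set.Iic (Nt : ℤ) × Fin q × H0 p → Lp ℂ 2 μ := fun i =>
    frameVec hμ (ξ i.2.1) (-(s i.2.1 : ℤ)) i.1 i.2.2 with hw
  have hwae : ∀ i, frameElt (ψ i.2.1) i.1 i.2.2 =ᵐ[μ] w i := fun i =>
    frameElt_ae_eq hμ (hψ' i.2.1) i.1 i.2.2
  set F := hf.toLp f with hF
  have hip : ∀ i, ip μ f (frameElt (ψ i.2.1) i.1 i.2.2) = inner ℂ (w i) F := by
    intro i
    rw [L2.inner_def, ip]
    refine integral_congr_ae ?_
    filter_upwards [hwae i, hf.coeFn_toLp] with x h1 h2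
    rw [h1, hF, h2, RCLike.inner_apply]
  obtain ⟨G, hG⟩ : Summable fun i => inner ℂ (w i) F • w i := summable_frameVec hμ hL hd Nt F
  refine ⟨G, ⟨Lp.memLp G, ?_⟩, ⟨_, isFourierTransform_plancherel hμ hL hf⟩, ?_⟩
  · have h1 : ∀ S : Finset (Set.Iic (Nt : ℤ) × Fin q × H0 p), eLpNorm (fun y => (∑ i ∈ S,
        ip μ f (frameElt (ψ i.2.1) i.1 i.2.2) * frameElt (ψ i.2.1) i.1 i.2.2 y) - G y) 2 μ =
        ‖(∑ i ∈ S, inner ℂ (w i) F • w i) - G‖ₑ := by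
      intro S
      refine enorm_sub_toLp_eq G ?_
      filter_upwards [coeFn_finsetSum_Lp S fun i => inner ℂ (w i) F • w i,
        (Finset.eventually_all S).2 fun i _ => hwae i,
        (Finset.eventually_all S).2 fun i _ => Lp.coeFn_smul (inner ℂ (w i) F) (w i)]
        with x h2 h3 h4
      rw [h2]
      refine Finset.sum_congr rfl fun i hi => ?_
      rw [h4 i hi, h3 i hi, hip, Pi.smul_apply, smul_eq_mul]
    simp only [h1]
    exact tendsto_iff_enorm_sub_tendsto_zero.1 hG
  intro fhat hfhat
  have hfhat' := hfhat.ae_eq hμ hL hf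
  have hres : ∀ n ≤ (Nt : ℤ), ∀ j, ∀ᵐ χ ∂ν, χ ∈ dualDil n '' E j → L (F - G) χ = 0 := by
    intro n hn j
    rw [hE']
    exact fourier_eq_zero_of_inner_frameVec hμ hL (by lia) fun h hh =>
      inner_frameVec_sub_hasSum hμ hL hd hG hn j ⟨h, hh⟩
  have hout : ∀ n > (Nt : ℤ), ∀ j, ∀ᵐ χ ∂ν, χ ∈ dualDil n '' E j → L G χ = 0 := by
    intro n hn j
    rw [hE']
    exact fourier_hasSum_eq_zero hμ hL hd hG hn j
  set U : Set (Dual p) := ⋃ n : Set.Ioi (Nt : ℤ), shell p ((n : ℤ) - l + M) with hU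
  have hshell : ∀ n > (Nt : ℤ), ∀ j, dualDil n '' E j ⊆ U := by
    intro n hn j χ hχ
    have h1 := dualDil_image_subset_shell htunion n j hχ
    have h2 : t j ≤ l := hl.2 ⟨j, rfl⟩
    -- The tile lies in the shell of index `n - t j + M`; the shift by `l` in the indexing of `U` is
    -- compensated here, and `t j ≤ l` keeps the index above `Nt`.
    refine Set.mem_iUnion.2 ⟨⟨n - t j + l, Set.mem_Ioi.2 (by lia)⟩, ?_⟩
    rwa [add_sub_cancel_right]
  -- Every `χ ≠ 1` lies in a tile. For `n ≤ Nt` the remainder's transform vanishes there; for `n >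
  -- Nt` that of `G` does, leaving `fhat`, and the tile is inside `U`.
  have hle : ∀ᵐ χ ∂ν, ‖L (F - G) χ‖ₑ ^ (2 : ℝ) ≤ U.indicator (fun χ => ‖fhat χ‖ₑ ^ 2) χ := by
    have hone : ∀ᵐ χ ∂ν, χ ≠ 1 := by
      rw [ae_iff]
      simpa using measure_singleton_one hν hr
    have h1 : ∀ᵐ χ ∂ν, ∀ n : ℤ, ∀ j, n ≤ Nt → χ ∈ dualDil n '' E j → L (F - G) χ = 0 :=
      ae_all_iff.2 fun n => ae_all_iff.2 fun j => by
        by_cases hn : n ≤ Nt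
        · filter_upwards [hres n hn j] with χ h _ using h
        · exact ae_of_all _ fun χ h => absurd h hn
    have h2 : ∀ᵐ χ ∂ν, ∀ n : ℤ, ∀ j, n > Nt → χ ∈ dualDil n '' E j → L G χ = 0 :=
      ae_all_iff.2 fun n => ae_all_iff.2 fun j => by
        by_cases hn : n > Nt
        · filter_upwards [hout n hn j] with χ h _ using h
        · exact ae_of_all _ fun χ h => absurd h hn
    have h3 : L (F - G) =ᵐ[ν] L F - L G := by
      rw [map_sub]
      exact Lp.coeFn_sub _ _
    filter_upwards [hone, h1, h2, h3, hfhat'] with χ hχ h4 h5 h6 h7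
    obtain ⟨n, j, hnj⟩ := exists_mem_dualDil_image htunion hχ
    rcases le_or_gt n Nt with hn | hn
    · rw [h4 n j hn hnj]
      simp
    · rw [Set.indicator_of_mem (hshell n hn j hnj), h6, Pi.sub_apply, h5 n j hn hnj, sub_zero, h7,
        ENNReal.rpow_two]
  have hUm : MeasurableSet U := MeasurableSet.iUnion fun n => measurableSet_shell _
  calc eLpNorm (fun x => f x - G x) 2 μ = ‖F - G‖ₑ := enorm_sub_toLp_eq G hf.coeFn_toLp.symm
    _ = ‖L (F - G)‖ₑ := (L.enorm_map _).symm
    _ = (∫⁻ χ, ‖L (F - G) χ‖ₑ ^ (2 : ℝ) ∂ν) ^ ((1 : ℝ) / 2) := by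
        rw [Lp.enorm_def, eLpNorm_eq_lintegral_rpow_enorm_toReal (by norm_num) (by norm_num),
          ENNReal.toReal_ofNat]
    _ ≤ (∑' n : Set.Ioi (Nt : ℤ), ∫⁻ χ in shell p ((n : ℤ) - l + M), ‖fhat χ‖ₑ ^ 2 ∂ν) ^
          ((1 : ℝ) / 2) := by
        refine ENNReal.rpow_le_rpow ?_ (by norm_num)
        refine (lintegral_mono_ae hle).trans ?_
        rw [lintegral_indicator hUm]
        exact lintegral_iUnion_le _ _
    _ ≤ ∑' n : Set.Ioi (Nt : ℤ),
          (∫⁻ χ in shell p ((n : ℤ) - l + M), ‖fhat χ‖ₑ ^ 2 ∂ν) ^ ((1 : ℝ) / 2) :=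
        ENNReal.tsum_rpow_half_le _
    _ ≤ _ := by
        -- The estimate already holds with constant one.
        refine le_mul_of_one_le_left' (one_le_mul ?_ le_add_self)
        rcases (Nat.zero_le M).eq_or_lt with h0 | h0
        · simp [← h0]
        · refine ENNReal.one_le_rpow ?_ (by positivity)
          exact_mod_cast (Fact.out : p.Prime).one_lt.le
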